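/- Let $d\ge 1$, let $\|\cdot\|$ and $\langle u,v\rangle=\int_{\mathbb R^d}u\,\overline v\,dx$ be the norm and inner product of $L^2(\mathbb R^d,\mathbb C)$, and let $(\mathcal Bu)(x)=\overline{u(-x)}$. Consider $$A\varphi-W(x,\omega)\varphi=f(x,\omega,\varphi),\qquad x\in\mathbb R^d,\tag{1}$$ and put $L(\omega)=A-W(\cdot,\omega)$ on $D(A)$ and $\|u\|_A=\|u\|+\|Au\|$. Balls in $D(A)$ are taken in $\|\cdot\|_A$. Let $\omega_0\in\mathbb R$, $\delta,\alpha,\beta,\lambda_0>0$, $\tau\in(0,\min\{1,\alpha\beta\}]$, and assume: * (A) $A:D(A)\to L^2(\mathbb R^d,\mathbb C)$ is densely defined and closed with non-empty resolvent set, and $D(A)\hookrightarrow L^\infty(\mathbb R^d,\mathbb C)$ continuously. * (W) $W(x,\cdot)$ is holomorphic on $B_\delta(\omega_0)\subset\mathbb C$ for a.e. $x$, and $\sup_{\omega\in B_\delta(\omega_0)}\|W(\cdot,\omega)\|_\infty<\infty$. * $\omega_0$ is an algebraically simple eigenvalue, $\ker L(\omega_0)^2=\ker L(\omega_0)=\langle\varphi_0\rangle$,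 and $L(\omega_0)$ has closed range. It is isolated: there is $\rho>0$ such that, for $\omega\in B_\rho(\omega_0)$, $0\in\sigma(L(\omega))$ if and only if $\omega=\omega_0$. Moreover $\varphi_0^*\in\ker L(\omega_0)^*$, $\|\varphi_0\|=1$, $\langle\varphi_0,\varphi_0^*\rangle=1$, and $\langle\partial_\omega W(\cdot,\omega_0)\varphi_0,\varphi_0^*\rangle\ne0$. * (f) $f(\cdot,\omega,\varphi(\cdot))\in L^2$ for all $\omega\in B_\delta(\omega_0)$ and $\varphi\in B_\delta(0)\subset D(A)$; there is $K$ such that for all $\lambda\in(0,\lambda_0)$, $\omega,\omega_1,\omega_2\in B_\delta(\omega_0)$ and $\varphi,\varphi_1,\varphi_2\in B_\delta(\varphi_0)\subset D(A)$ $$\|f(\cdot,\omega_1,\lambda\varphi)-f(\cdot,\omega_2,\lambda\varphi)\|\le K\lambda^{\frac1\alpha+1}|\omega_1-\omega_2|,\qquad \|f(\cdot,\omega,\lambda\varphi_1)-f(\cdot,\omega,\lambda\varphi_2)\|\le K\lambda^{\frac1\alpha+1}\|\varphi_1-\varphi_2\|;$$ and there are $g_\omega\in L^\infty(\mathbb R^d,\mathbb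 C)\setminus\{0\}$, $\omega\in B_\delta(\omega_0)$, with $\|g_{\omega_1}-g_{\omega_2}\|_\infty\le K_g|\omega_1-\omega_2|$ for a constant $K_g$, such that $f(x,\omega,z)-g_\omega(x)|z|^{\frac1\alpha}z=O(|z|^{\frac1\alpha+1+\beta})$ as $\mathbb C\ni z\to0$, uniformly in $\omega\in B_\delta(\omega_0)$ and a.e. $x$. * ($\mathcal{PT}$) $\mathcal B D(A)\subset D(A)$ and $A\mathcal B=\mathcal BA$ on $D(A)$; and for all real $\omega\in B_\delta(\omega_0)$: $\mathcal BW(\cdot,\omega)=W(\cdot,\omega)$, $\mathcal Bg_\omega=g_\omega$, and $f(\cdot,\omega,\mathcal B\varphi)=\mathcal B\big(f(\cdot,\omega,\varphi)\big)$ for all $\varphi\in B_\delta(0)\subset D(A)$. Then $\mathcal B(c\varphi_0)=c\varphi_0$ for some $c\in\mathbb C$ with $|c|=1$, so the normalized eigenfunction can be chosen $\mathcal{PT}$-symmetric. If $\mathcal B\varphi_0=\varphi_0$, then there are $\varepsilon_0,\eta,r>0$, $\nu\in\mathbb C$ and $\phi\in D(A)\cap\langle\varphi_0^*\rangle^\perp$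 such that for every $\varepsilon\in(0,\varepsilon_0)$ the equation (1) with the constraint $\langle\varphi,\varphi_0^*\rangle=\varepsilon^\alpha$ has exactly one solution $(\omega,\varphi)\in\mathbb C\times D(A)$ with $|\omega-\omega_0|<\eta$ and $\|\varphi-\varepsilon^\alpha\varphi_0\|_A<\eta\,\varepsilon^\alpha$; it has the form $$\omega=\omega_0+\varepsilon\nu+\varepsilon^{1+\tau}\sigma,\qquad \varphi=\varepsilon^\alpha\varphi_0+\varepsilon^{\alpha+1}\phi+\varepsilon^{\alpha+1+\tau}\psi$$ with some $\sigma\in\mathbb C$, $\psi\in D(A)\cap\langle\varphi_0^*\rangle^\perp$ (depending on $\varepsilon$), $|\sigma|\le r$, $\|\psi\|_A\le r$; and it satisfies $\omega\in\mathbb R$ and $\mathcal B\varphi=\varphi$. -/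

import Mathlib

open MeasureTheory Set
open scoped ENNReal ComplexConjugate

noncomputable section

namespace PTBif

/-- The Euclidean space `ℝ^d`. -/
abbrev Rd (d : ℕ) : Type := EuclideanSpace ℝ (Fin d)

/-- The complex Hilbert space `L²(ℝ^d, ℂ)`. -/
abbrev L2 (d : ℕ) : Type := Lp ℂ 2 (volume : Measure (Rd d))

/-- A (possibly unbounded) linear operator in `L²(ℝ^d, ℂ)` with its domain. -/
abbrev Op (d : ℕ) : Type := L2 d →ₗ.[ℂ] L2 d

variable {d : ℕ}

/-! ### The symmetry -/

/-- `(ℬ u)(x) = conj (u (-x))` on functions. -/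
def ptFun (u : Rd d → ℂ) : Rd d → ℂ := fun x => conj (u (-x))

theorem memLp_ptFun {u : Rd d → ℂ} {p : ℝ≥0∞} (hu : MemLp u p volume) :
    MemLp (ptFun u) p volume := by
  have h : MemLp (fun x => u (-x)) p volume :=
    hu.comp_measurePreserving (Measure.measurePreserving_neg volume)
  exact h.star

/-- `ℬ` on `L²(ℝ^d, ℂ)`. -/
def PT (u : L2 d) : L2 d := (memLp_ptFun (Lp.memLp u)).toLp _

theorem coeFn_PT (u : L2 d) : PT u =ᵐ[volume] fun x => conj (u (-x)) :=
  MemLp.coeFn_toLp _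

/-- A function is `PT`-symmetric if `ℬ w = w` (as an element of a Lebesgue space). -/
def PTFunction (w : Rd d → ℂ) : Prop := ∀ᵐ x, conj (w (-x)) = w x

/-- An operator is `PT`-symmetric if `ℬ` preserves its domain and commutes with it there. -/
def PTOperator (T : Op d) : Prop :=
  ∀ u : T.domain, ∃ h : PT (u : L2 d) ∈ T.domain, T ⟨PT u, h⟩ = PT (T u)

/-! ### Unbounded operators -/

/-- The graph norm `‖u‖_T = ‖u‖ + ‖T u‖` on the domain of `T`. -/
def graphNorm (T : Op d) (u : T.domain) : ℝ := ‖(u : L2 d)‖ + ‖T u‖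

/-- `z` is in the resolvent set of `T`: `z - T : D(T) → L²` has a bounded two-sided inverse. -/
def InResolventSet (T : Op d) (z : ℂ) : Prop :=
  ∃ R : L2 d →L[ℂ] L2 d,
    (∀ y, ∃ h : R y ∈ T.domain, z • R y - T ⟨R y, h⟩ = y) ∧
    ∀ u : T.domain, R (z • (u : L2 d) - T u) = u

/-- `z` is in the spectrum of `T`. -/
def InSpectrum (T : Op d) (z : ℂ) : Prop := ¬ InResolventSet T z

/-- Multiplication by a function `w ∈ L^∞` as an operator on `L²` (and `0` if `w ∉ L^∞`). -/
def mulOp (w : Rd d → ℂ) : L2 d →L[ℂ] L2 d :=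
  open Classical in
  if hw : MemLp w ∞ volume then
    (ContinuousLinearMap.mul ℂ ℂ).holderL volume ∞ 2 2 (hw.toLp w)
  else 0

theorem coeFn_mulOp {w : Rd d → ℂ} (hw : MemLp w ∞ volume) (u : L2 d) :
    mulOp w u =ᵐ[volume] fun x => w x * u x := by
  have h1 := (ContinuousLinearMap.mul ℂ ℂ).coeFn_holder (r := 2) (hw.toLp w) u
  have h2 := hw.coeFn_toLp
  rw [mulOp, dif_pos hw]
  filter_upwards [h1, h2] with x hx hx2
  rw [hx2] at hx
  exact hx

/-- `L(·, ω) = A - W(·, ω)` with domain `D(A)`. -/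
def opL (A : Op d) (W : Rd d → ℂ → ℂ) (ω : ℂ) : Op d where
  domain := A.domain
  toFun := A.toFun - (mulOp fun x => W x ω).toLinearMap ∘ₗ A.domain.subtype

/-! ### Assumptions on the linear problem -/

/-- `A` is densely defined and closed with non-empty resolvent set, and `D(A)` with the graph
norm embeds continuously into `L^∞`. -/
structure AssumptionA (A : Op d) : Prop where
  dense : Dense (A.domain : Set (L2 d))
  closed : A.IsClosed
  resolvent : ∃ z, InResolventSet A z
  embedding : ∃ C : ℝ, ∀ u : A.domain,
    eLpNorm (u : L2 d) ∞ volume ≤ ENNReal.ofReal (C * graphNorm A u)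

/-- `W(x, ·)` is holomorphic on `B_δ(ω₀)` for a.e. `x`, and `W(·, ω)` is bounded in `L^∞` uniformly
in `ω ∈ B_δ(ω₀)`. -/
structure AssumptionW (W : Rd d → ℂ → ℂ) (ω₀ : ℂ) (δ : ℝ) : Prop where
  holomorphic : ∀ᵐ x : Rd d, DifferentiableOn ℂ (W x) (Metric.ball ω₀ δ)
  bounded : ∃ c : ℝ, ∀ ω ∈ Metric.ball ω₀ δ, MemLp (fun x => W x ω) ∞ volume ∧
    eLpNorm (fun x => W x ω) ∞ volume ≤ ENNReal.ofReal c

/-- `ω₀` is an algebraically simple eigenvalue: `ker L(·, ω₀)² = ker L(·, ω₀) = ⟨φ₀⟩`, with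
`ran L(·, ω₀)` closed. -/
structure AlgebraicallySimple (A : Op d) (W : Rd d → ℂ → ℂ) (ω₀ : ℂ) (φ₀ : A.domain) : Prop where
  ker : ∀ u : (opL A W ω₀).domain, opL A W ω₀ u = 0 ↔ ∃ c : ℂ, (u : L2 d) = c • (φ₀ : L2 d)
  ker_sq : ∀ (u : (opL A W ω₀).domain) (h : opL A W ω₀ u ∈ (opL A W ω₀).domain),
    opL A W ω₀ ⟨opL A W ω₀ u, h⟩ = 0 → opL A W ω₀ u = 0
  closed_range : IsClosed (Set.range fun u : (opL A W ω₀).domain => opL A W ω₀ u)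

/-- `ω₀` is isolated: near `ω₀`, `0` is in the spectrum of `L(·, ω)` only for `ω = ω₀`. -/
def Isolated (A : Op d) (W : Rd d → ℂ → ℂ) (ω₀ : ℂ) : Prop :=
  ∃ ρ : ℝ, 0 < ρ ∧ ∀ ω ∈ Metric.ball ω₀ ρ, InSpectrum (opL A W ω) 0 ↔ ω = ω₀

/-- `φ₀` is normalized and `φs` is the eigenfunction of the Hilbert space adjoint of `L(·, ω₀)` with
`⟨φ₀, φs⟩ = 1`. (Mathlib's inner product is linear in its second argument.) -/
structure Normalized (A : Op d) (W : Rd d → ℂ → ℂ) (ω₀ : ℂ) (φ₀ : A.domain) (φs : L2 d) :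
    Prop where
  norm_one : ‖(φ₀ : L2 d)‖ = 1
  adjoint_ker : ∃ h : φs ∈ (opL A W ω₀).adjoint.domain, (opL A W ω₀).adjoint ⟨φs, h⟩ = 0
  inner_one : inner ℂ φs (φ₀ : L2 d) = 1

/-- `⟨∂_ω W(·, ω₀) φ₀, φs⟩ ≠ 0`. -/
def Transversal (W : Rd d → ℂ → ℂ) (ω₀ : ℂ) (φ₀ φs : L2 d) : Prop :=
  ∫ x, deriv (W x) ω₀ * φ₀ x * conj (φs x) ≠ 0

/-! ### Assumptions on the nonlinearity -/

/-- The assumptions on the nonlinearity `f(x, ω, φ)` and on its leading coefficient `g ω`. Balls in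
`D(A)` are taken in the graph norm. -/
structure AssumptionF (A : Op d) (ω₀ : ℂ) (φ₀ : A.domain) (δ α β : ℝ)
    (f : Rd d → ℂ → ℂ → ℂ) (g : ℂ → Rd d → ℂ) : Prop where
  memL2 : ∀ ω ∈ Metric.ball ω₀ δ, ∀ u : A.domain, graphNorm A u < δ →
    MemLp (fun x => f x ω ((u : L2 d) x)) 2 volume
  lipschitz : ∃ l₀ : ℝ, 0 < l₀ ∧ ∃ K : ℝ, ∀ l ∈ Ioo (0 : ℝ) l₀,
    (∀ ω₁ ∈ Metric.ball ω₀ δ, ∀ ω₂ ∈ Metric.ball ω₀ δ, ∀ u : A.domain, graphNorm A (u - φ₀) < δ →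
      eLpNorm (fun x => f x ω₁ ((l : ℂ) * (u : L2 d) x) - f x ω₂ ((l : ℂ) * (u : L2 d) x)) 2 volume
        ≤ ENNReal.ofReal (K * l ^ (1 / α + 1) * ‖ω₁ - ω₂‖)) ∧
    (∀ ω ∈ Metric.ball ω₀ δ, ∀ u₁ u₂ : A.domain,
      graphNorm A (u₁ - φ₀) < δ → graphNorm A (u₂ - φ₀) < δ →
      eLpNorm (fun x => f x ω ((l : ℂ) * (u₁ : L2 d) x) - f x ω ((l : ℂ) * (u₂ : L2 d) x)) 2 volume
        ≤ ENNReal.ofReal (K * l ^ (1 / α + 1) * ‖(u₁ : L2 d) - (u₂ : L2 d)‖))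
  g_mem : ∀ ω ∈ Metric.ball ω₀ δ, MemLp (g ω) ∞ volume ∧ ¬ (g ω =ᵐ[volume] 0)
  asymptotics : ∃ C : ℝ, ∃ s : ℝ, 0 < s ∧ ∀ ω ∈ Metric.ball ω₀ δ, ∀ᵐ x : Rd d, ∀ z : ℂ, ‖z‖ < s →
    ‖f x ω z - g ω x * ((‖z‖ ^ (1 / α) : ℝ) : ℂ) * z‖ ≤ C * ‖z‖ ^ (1 / α + 1 + β)
  g_lipschitz : ∃ K : ℝ, ∀ ω₁ ∈ Metric.ball ω₀ δ, ∀ ω₂ ∈ Metric.ball ω₀ δ,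
    eLpNorm (fun x => g ω₁ x - g ω₂ x) ∞ volume ≤ ENNReal.ofReal (K * ‖ω₁ - ω₂‖)

/-- `A`, `W(·, ω)`, `φ ↦ f(·, ω, φ)` (on the ball of `D(A)` where it maps into `L²`) and `g ω` are
`PT`-symmetric, for real `ω` near `ω₀`. -/
structure PTSymmetricProblem (A : Op d) (W : Rd d → ℂ → ℂ) (f : Rd d → ℂ → ℂ → ℂ)
    (g : ℂ → Rd d → ℂ) (ω₀ δ : ℝ) : Prop where
  opA : PTOperator A
  potential : ∀ ω : ℝ, |ω - ω₀| < δ → PTFunction fun x => W x ω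
  nonlinearity : ∀ ω : ℝ, |ω - ω₀| < δ → ∀ u : A.domain, graphNorm A u < δ →
    ∀ᵐ x, f x ω (PT (u : L2 d) x) = conj (f (-x) ω ((u : L2 d) (-x)))
  coefficient : ∀ ω : ℝ, |ω - ω₀| < δ → PTFunction (g ω)

/-! ### The nonlinear eigenvalue problem -/

/-- `A φ - W(x, ω) φ = f(x, ω, φ)` in `ℝ^d`. -/
def Solves (A : Op d) (W : Rd d → ℂ → ℂ) (f : Rd d → ℂ → ℂ → ℂ) (ω : ℂ) (φ : A.domain) : Prop :=
  ∀ᵐ x, A φ x - W x ω * (φ : L2 d) x = f x ω ((φ : L2 d) x)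

/-- `(ω, φ)` solves the problem with the constraint `⟨φ, φs⟩ = ε^α`, and is close to
`(ω₀, ε^α φ₀)`: `|ω - ω₀| < η` and `‖φ - ε^α φ₀‖_A < η ε^α`. -/
structure LocalSolution (A : Op d) (W : Rd d → ℂ → ℂ) (f : Rd d → ℂ → ℂ → ℂ) (ω₀ : ℂ)
    (φ₀ : A.domain) (φs : L2 d) (α η ε : ℝ) (ω : ℂ) (φ : A.domain) : Prop where
  solves : Solves A W f ω φ
  constraint : inner ℂ φs (φ : L2 d) = ((ε ^ α : ℝ) : ℂ)
  near_omega : ‖ω - ω₀‖ < η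
  near_phi : graphNorm A (φ - ((ε ^ α : ℝ) : ℂ) • φ₀) < η * ε ^ α

end PTBif

end

/-!
Lyapunov–Schmidt reduction. Put `φ = ε^α (φ₀ + u)` and `ω = ω₀ + μ` with `u ⟂ φs`. Since
`L(ω₀) φ₀ = 0`, the problem for `(u, μ)` becomes `L(ω₀) u - μ ∂_ω W(·, ω₀) φ₀ = N(ε, u, μ)` where
`N` is Lipschitz near `0` with a small constant and `N(ε, 0, 0) = ε g |φ₀|^{1/α} φ₀ + O(ε^{1 + τ})`.
The left-hand side, together with `⟨u, φs⟩`, is an isomorphism for the graph norm: the range of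
`L(ω₀)` is the orthogonal complement of `φs`, because `L(ω₀)` has closed range and is a limit of
the surjective operators `L(ω)`, so that its cokernel is at most as large as its kernel, and
transversality keeps `∂_ω W(·, ω₀) φ₀` outside it. Applying the inverse `T` turns the problem into a
contraction, whose fixed point is `ε T (g |φ₀|^{1/α} φ₀) + O(ε^{1 + τ})`.
On the closed real subspace of pairs with `u` symmetric and `μ` real, both `T` and `N` act, so that
the fixed point, being unique, is symmetric.
-/

open Filter
open scoped Topology

noncomputable section

namespace PTBif

variable {d : ℕ}

section BorderedOperator

variable {𝕜 E F : Type*} [NormedAddCommGroup E] [NormedAddCommGroup F]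

section NormedField

variable [NontriviallyNormedField 𝕜] [NormedSpace 𝕜 E] [NormedSpace 𝕜 F]

theorem eq_zero_of_ker_eq_span {T : E →L[𝕜] F} {ℓ : E →L[𝕜] 𝕜} {e u : E}
    (hker : T.ker = 𝕜 ∙ e) (hℓ : ℓ e = 1) (hTu : T u = 0) (hℓu : ℓ u = 0) : u = 0 := by
  have hu : u ∈ T.ker := hTu
  rw [hker] at hu
  obtain ⟨a, rfl⟩ := Submodule.mem_span_singleton.1 hu
  have ha : a = 0 := by simpa [hℓ] using hℓu
  rw [ha, zero_smul]

theorem apply_eq_zero_of_ker_eq_span {T : E →L[𝕜] F} {e : E} (hker : T.ker = 𝕜 ∙ e) :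
    T e = 0 := by
  have he : e ∈ T.ker := hker ▸ Submodule.mem_span_singleton_self e
  exact he

theorem exists_pos_mul_norm_le_norm_apply [CompleteSpace 𝕜] [CompleteSpace E] [CompleteSpace F]
    {T : E →L[𝕜] F} {ℓ : E →L[𝕜] 𝕜} {e : E} (hker : T.ker = 𝕜 ∙ e) (hℓ : ℓ e = 1)
    (hT : IsClosed (T.range : Set F)) : ∃ c > 0, ∀ u, ℓ u = 0 → c * ‖u‖ ≤ ‖T u‖ := by
  have hinj : Function.Injective (T.prod ℓ) := by
    refine (injective_iff_map_eq_zero _).2 fun u hu => ?_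
    obtain ⟨hTu, hℓu⟩ := Prod.mk.inj hu
    exact eq_zero_of_ker_eq_span hker hℓ hTu hℓu
  have hrange : range (T.prod ℓ) = (T.range : Set F) ×ˢ univ := by
    refine Subset.antisymm (range_subset_iff.2 fun u => ⟨⟨u, rfl⟩, mem_univ _⟩) ?_
    rintro ⟨_, s⟩ ⟨⟨u, rfl⟩, -⟩
    exact ⟨u + (s - ℓ u) • e, by simp [apply_eq_zero_of_ker_eq_span hker, hℓ]⟩
  obtain ⟨K, hK⟩ := (T.prod ℓ).antilipschitz_of_injective_of_isClosed_range hinj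
    (hrange ▸ hT.prod isClosed_univ)
  refine ⟨(K + 1 : ℝ)⁻¹, by positivity, fun u hu => ?_⟩
  have hle : ‖u‖ ≤ K * ‖T u‖ := by
    simpa [Prod.norm_def, hu] using ZeroHomClass.bound_of_antilipschitz _ hK u
  rw [inv_mul_le_iff₀ (by positivity)]
  linarith [norm_nonneg (T u)]

/-- The bordered operator `(u, μ) ↦ (T u - μ b, ℓ u)` of Lyapunov–Schmidt reduction: if `T` has a
one-dimensional kernel and cokernel, then suitable `b` and `ℓ` make it invertible. -/
def bordered (T : E →L[𝕜] F) (b : F) (ℓ : E →L[𝕜] 𝕜) : E × 𝕜 →L[𝕜] F × 𝕜 :=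
  (T.coprod (-ContinuousLinearMap.toSpanSingleton 𝕜 b)).prod (ℓ ∘L ContinuousLinearMap.fst 𝕜 E 𝕜)

theorem bordered_apply (T : E →L[𝕜] F) (b : F) (ℓ : E →L[𝕜] 𝕜) (p : E × 𝕜) :
    bordered T b ℓ p = (T p.1 - p.2 • b, ℓ p.1) := by
  simp [bordered, sub_eq_add_neg]

variable {T : E →L[𝕜] F} {b : F} {ℓ : E →L[𝕜] 𝕜} {e : E} {m : F →L[𝕜] 𝕜}

theorem ker_bordered_eq_bot (hker : T.ker = 𝕜 ∙ e) (hℓ : ℓ e = 1) (hrange : T.range ≤ m.ker)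
    (hb : m b ≠ 0) : (bordered T b ℓ).ker = ⊥ := by
  refine LinearMap.ker_eq_bot'.2 fun ⟨u, μ⟩ h => ?_
  obtain ⟨h₁, h₂⟩ := Prod.mk.inj ((bordered_apply T b ℓ (u, μ)).symm.trans h)
  have hm : m (T u) = 0 := hrange ⟨u, rfl⟩
  obtain rfl : μ = 0 := by simpa [sub_eq_zero.1 h₁, hb] using hm
  exact Prod.ext (eq_zero_of_ker_eq_span hker hℓ (by simpa using h₁) h₂) rfl

theorem range_bordered_eq_top (hTe : T e = 0) (hℓ : ℓ e = 1) (hrange : m.ker ≤ T.range)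
    (hb : m b ≠ 0) : (bordered T b ℓ).range = ⊤ := by
  refine LinearMap.range_eq_top.2 fun ⟨y, s⟩ => ?_
  obtain ⟨u, hu⟩ : y - (m y / m b) • b ∈ T.range := hrange (by simp [hb])
  refine ⟨(u + (s - ℓ u) • e, -(m y / m b)), (bordered_apply T b ℓ _).trans ?_⟩
  have hTu : T u = y - (m y / m b) • b := hu
  simp [hTe, hℓ, hTu]

end NormedField

section Hilbert

variable [RCLike 𝕜] [NormedSpace 𝕜 E] [InnerProductSpace 𝕜 F] {T S : E →L[𝕜] F}
  {ℓ : E →L[𝕜] 𝕜} {e : E} {n : F}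

theorem eq_zero_of_apply_mem_orthogonal_range {c : ℝ} {v : E} (hv : c * ‖v‖ ≤ ‖T v‖)
    (hTS : ‖T - S‖ < c) (hSv : S v ∈ T.rangeᗮ) : S v = 0 := by
  -- `‖T v‖² + ‖S v‖² = ‖(T - S) v‖² ≤ c² ‖v‖²` by orthogonality.
  have hpyth : ‖T v - S v‖ * ‖T v - S v‖ = ‖T v‖ * ‖T v‖ + ‖S v‖ * ‖S v‖ := by
    have horth : inner 𝕜 (T v) (-S v) = 0 := by
      rw [inner_neg_right, neg_eq_zero]
      exact hSv (T v) ⟨v, rfl⟩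
    simpa [sub_eq_add_neg] using norm_add_sq_eq_norm_sq_add_norm_sq_of_inner_eq_zero _ _ horth
  have hle : ‖T v - S v‖ ≤ ‖T v‖ :=
    calc ‖T v - S v‖ ≤ ‖T - S‖ * ‖v‖ := (T - S).le_opNorm v
      _ ≤ c * ‖v‖ := by gcongr
      _ ≤ ‖T v‖ := hv
  have hsq := mul_self_le_mul_self (norm_nonneg _) hle
  exact norm_eq_zero.1 (mul_self_eq_zero.1 (by nlinarith [mul_self_nonneg ‖S v‖]))

theorem orthogonal_range_eq_span_singleton {c : ℝ} (hc : ∀ u, ℓ u = 0 → c * ‖u‖ ≤ ‖T u‖)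
    (hn : n ∈ T.rangeᗮ) (hn0 : n ≠ 0) (hS : Function.Surjective S) (hTS : ‖T - S‖ < c) :
    T.rangeᗮ = 𝕜 ∙ n := by
  refine le_antisymm (fun m hm => ?_) ((Submodule.span_singleton_le_iff_mem _ _).2 hn)
  obtain ⟨v₀, hv₀⟩ := hS n
  obtain ⟨v, hv⟩ := hS m
  have hℓv₀ : ℓ v₀ ≠ 0 := fun h => hn0 <| by
    rw [← hv₀, eq_zero_of_apply_mem_orthogonal_range (hc v₀ h) hTS (hv₀ ▸ hn)]
  set w := v - (ℓ v / ℓ v₀) • v₀ with hw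
  have hSw : S w = m - (ℓ v / ℓ v₀) • n := by rw [hw, map_sub, map_smul, hv, hv₀]
  have hSw0 : S w = 0 := eq_zero_of_apply_mem_orthogonal_range
    (hc w (by simp [hw, hℓv₀])) hTS (hSw ▸ sub_mem hm (T.rangeᗮ.smul_mem _ hn))
  exact Submodule.mem_span_singleton.2 ⟨_, (sub_eq_zero.1 (hSw ▸ hSw0)).symm⟩

theorem range_eq_orthogonal_span_singleton [CompleteSpace E] [CompleteSpace F]
    (hker : T.ker = 𝕜 ∙ e) (hℓ : ℓ e = 1) (hclosed : IsClosed (T.range : Set F))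
    (hn : n ∈ T.rangeᗮ) (hn0 : n ≠ 0)
    (hT : T ∈ closure {S : E →L[𝕜] F | Function.Surjective S}) : T.range = (𝕜 ∙ n)ᗮ := by
  obtain ⟨c, hc0, hc⟩ := exists_pos_mul_norm_le_norm_apply hker hℓ hclosed
  obtain ⟨S, hS, hTS⟩ := Metric.mem_closure_iff.1 hT c hc0
  rw [dist_eq_norm] at hTS
  rw [← orthogonal_range_eq_span_singleton hc hn hn0 hS hTS,
    Submodule.orthogonal_orthogonal_eq_closure, hclosed.submodule_topologicalClosure_eq]

end Hilbert

end BorderedOperator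

section FixedPoint

variable {E : Type*} [NormedAddCommGroup E] {S : Set E}

theorem exists_unique_fixedPoint_of_lipschitz_half [CompleteSpace E] {Φ : E → E} {ρ : ℝ}
    (hS : IsClosed S) (h0 : (0 : E) ∈ S) (hinv : ∀ p ∈ S, ‖p‖ ≤ ρ → Φ p ∈ S)
    (hlip : ∀ p q, ‖p‖ ≤ ρ → ‖q‖ ≤ ρ → ‖Φ p - Φ q‖ ≤ 1 / 2 * ‖p - q‖) (hρ : ‖Φ 0‖ ≤ ρ / 2) :
    ∃ p ∈ S, ‖p‖ ≤ 2 * ‖Φ 0‖ ∧ Φ p = p ∧ ∀ q, ‖q‖ ≤ ρ → Φ q = q → q = p := by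
  have hρ0 : 0 ≤ ρ := by linarith [norm_nonneg (Φ 0)]
  have hnorm : ∀ p, ‖p‖ ≤ ρ → ‖Φ p‖ ≤ ‖Φ 0‖ + 1 / 2 * ‖p‖ := fun p hp => by
    have := hlip p 0 hp (by simpa)
    rw [sub_zero] at this
    linarith [norm_sub_norm_le (Φ p) (Φ 0)]
  have hmaps : MapsTo Φ (S ∩ Metric.closedBall 0 ρ) (S ∩ Metric.closedBall 0 ρ) := by
    rintro p ⟨hpS, hp⟩
    rw [mem_closedBall_zero_iff] at hp
    exact ⟨hinv p hpS hp, mem_closedBall_zero_iff.2 (by linarith [hnorm p hp])⟩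
  have hcontr : ContractingWith (1 / 2) (hmaps.restrict Φ _ _) := by
    refine ⟨by norm_num, LipschitzWith.of_dist_le_mul fun p q => ?_⟩
    simpa [Subtype.dist_eq, dist_eq_norm] using
      hlip p q (mem_closedBall_zero_iff.1 p.2.2) (mem_closedBall_zero_iff.1 q.2.2)
  obtain ⟨p, ⟨hpS, hp⟩, hΦp, -⟩ := hcontr.exists_fixedPoint'
    (hS.inter Metric.isClosed_closedBall).isComplete hmaps
    ⟨h0, Metric.mem_closedBall_self hρ0⟩ (edist_ne_top _ _)
  rw [mem_closedBall_zero_iff] at hp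
  have hΦp : Φ p = p := hΦp
  refine ⟨p, hpS, ?_, hΦp, fun q hq hΦq => ?_⟩
  · have := hnorm p hp
    rw [hΦp] at this
    linarith
  · have := hlip q p hq hp
    rw [hΦp, hΦq] at this
    exact sub_eq_zero.1 (norm_le_zero_iff.1 (by linarith))

theorem exists_fixedPoint_branch [CompleteSpace E] {Φ : ℝ → E → E} {κ ρ₁ : ℝ}
    (hS : IsClosed S) (h0 : (0 : E) ∈ S) (hκ : 0 < κ) (hρ₁ : 0 < ρ₁)
    (hinv : ∀ᶠ ε in 𝓝[>] 0, ∀ p ∈ S, ‖p‖ ≤ ρ₁ → Φ ε p ∈ S)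
    (hlip : ∀ᶠ ε in 𝓝[>] 0, ∀ ρ ≤ ρ₁, ∀ p q, ‖p‖ ≤ ρ → ‖q‖ ≤ ρ →
      ‖Φ ε p - Φ ε q‖ ≤ κ * (ρ + ε) * ‖p - q‖)
    (hΦ0 : ∀ᶠ ε in 𝓝[>] 0, ‖Φ ε 0‖ ≤ κ * ε) :
    ∃ ρ > 0, ρ ≤ ρ₁ ∧ ∃ C > 0, ∀ᶠ ε in 𝓝[>] 0, ∃ p ∈ S, ‖p‖ < ρ ∧ Φ ε p = p ∧
      (∀ q, ‖q‖ < ρ → Φ ε q = q → q = p) ∧ ‖p - Φ ε 0‖ ≤ C * ε ^ 2 := by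
  set ρ := min ρ₁ (1 / (4 * κ))
  have hρ0 : 0 < ρ := lt_min hρ₁ (by positivity)
  have hκρ : κ * ρ ≤ 1 / 4 :=
    calc κ * ρ ≤ κ * (1 / (4 * κ)) := by gcongr; exact min_le_right _ _
      _ = 1 / 4 := by field_simp
  have hsmall : ∀ᶠ ε in 𝓝[>] (0 : ℝ), κ * ε < min (1 / 4) (ρ / 4) := by
    have : Tendsto (fun ε : ℝ => κ * ε) (𝓝[>] 0) (𝓝 0) :=
      tendsto_nhdsWithin_of_tendsto_nhds ((continuous_const_mul κ).tendsto' 0 0 (mul_zero κ))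
    exact this.eventually_lt_const (lt_min (by norm_num) (by positivity))
  refine ⟨ρ, hρ0, min_le_left _ _, κ * (2 * κ + 1) * (2 * κ), by positivity, ?_⟩
  filter_upwards [hinv, hlip, hΦ0, hsmall, self_mem_nhdsWithin] with ε hinv hlip hΦ0 hsmall hε
  obtain ⟨hsmall₁, hsmall₂⟩ := lt_min_iff.1 hsmall
  obtain ⟨p, hpS, hp, hΦp, huniq⟩ := exists_unique_fixedPoint_of_lipschitz_half hS h0
    (fun p hp hpρ => hinv p hp (hpρ.trans (min_le_left _ _)))
    (fun p q hp hq => (hlip ρ (min_le_left _ _) p q hp hq).trans (by gcongr; linarith))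
    (by linarith : ‖Φ ε 0‖ ≤ ρ / 2)
  have hpε : ‖p‖ ≤ 2 * κ * ε := by linarith
  have hpρ : ‖p‖ < ρ := by linarith
  refine ⟨p, hpS, hpρ, hΦp, fun q hq => huniq q hq.le, ?_⟩
  have hε : 0 < ε := hε
  calc ‖p - Φ ε 0‖ = ‖Φ ε p - Φ ε 0‖ := by rw [hΦp]
    _ ≤ κ * (2 * κ * ε + ε) * ‖p - 0‖ :=
      hlip _ (by linarith [min_le_left ρ₁ (1 / (4 * κ))]) p 0 hpε (by rw [norm_zero]; positivity)
    _ ≤ κ * (2 * κ * ε + ε) * (2 * κ * ε) := by rw [sub_zero]; gcongr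
    _ = κ * (2 * κ + 1) * (2 * κ) * ε ^ 2 := by ring

theorem exists_eq_add_smul_of_norm_sub_le [NormedSpace ℂ E] {p q : E} {t C : ℝ} (ht : 0 < t)
    (h : ‖p - q‖ ≤ C * t) : ∃ s : E, ‖s‖ ≤ C ∧ p = q + (t : ℂ) • s := by
  refine ⟨(t : ℂ)⁻¹ • (p - q), ?_, ?_⟩
  · rwa [norm_smul, norm_inv, Complex.norm_real, Real.norm_of_nonneg ht.le, inv_mul_le_iff₀ ht,
      mul_comm]
  · rw [smul_inv_smul₀ (Complex.ofReal_ne_zero.2 ht.ne'), add_sub_cancel]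

theorem norm_le_mul_of_norm_sub_smul_le [NormedSpace ℂ E] {p e : E} {ε C τ : ℝ} (hε : 0 < ε)
    (hε1 : ε ≤ 1) (hτ : 0 ≤ τ) (hC : 0 ≤ C) (h : ‖p - (ε : ℂ) • e‖ ≤ C * ε ^ (1 + τ)) :
    ‖p‖ ≤ (C + ‖e‖) * ε := by
  have hpow : ε ^ (1 + τ) ≤ ε := by
    simpa only [Real.rpow_one] using
      Real.rpow_le_rpow_of_exponent_ge hε hε1 (le_add_of_nonneg_right hτ : 1 ≤ 1 + τ)
  calc ‖p‖ ≤ ‖p - (ε : ℂ) • e‖ + ‖(ε : ℂ) • e‖ := norm_le_norm_sub_add _ _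
    _ ≤ C * ε + ε * ‖e‖ := by
      rw [norm_smul, Complex.norm_real, Real.norm_of_nonneg hε.le]
      gcongr
      exact h.trans (mul_le_mul_of_nonneg_left hpow hC)
    _ = (C + ‖e‖) * ε := by ring

theorem exists_fixedPoint_branch_expansion [CompleteSpace E] [NormedSpace ℂ E] {Φ : ℝ → E → E}
    {κ ρ₁ C τ : ℝ} {e : E} (hS : IsClosed S) (h0 : (0 : E) ∈ S) (hκ : 0 ≤ κ) (hρ₁ : 0 < ρ₁)
    (hC : 0 ≤ C) (hτ : 0 ≤ τ) (hτ' : τ ≤ 1)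
    (hinv : ∀ᶠ ε in 𝓝[>] 0, ∀ p ∈ S, ‖p‖ ≤ ρ₁ → Φ ε p ∈ S)
    (hlip : ∀ᶠ ε in 𝓝[>] 0, ∀ ρ ≤ ρ₁, ∀ p q, ‖p‖ ≤ ρ → ‖q‖ ≤ ρ →
      ‖Φ ε p - Φ ε q‖ ≤ κ * (ρ + ε) * ‖p - q‖)
    (hΦ0 : ∀ᶠ ε in 𝓝[>] 0, ‖Φ ε 0 - (ε : ℂ) • e‖ ≤ C * ε ^ (1 + τ)) :
    ∃ ρ > 0, ρ ≤ ρ₁ ∧ ∃ r > 0, ∀ᶠ ε : ℝ in 𝓝[>] 0, ∃ p ∈ S,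
      (∀ q, ‖q‖ < ρ ∧ Φ ε q = q ↔ q = p) ∧
      ∃ s, ‖s‖ ≤ r ∧ p = (ε : ℂ) • e + ((ε ^ (1 + τ) : ℝ) : ℂ) • s := by
  set κ' := κ + (C + ‖e‖) + 1
  have hlip' : ∀ᶠ ε in 𝓝[>] 0, ∀ ρ ≤ ρ₁, ∀ p q, ‖p‖ ≤ ρ → ‖q‖ ≤ ρ →
      ‖Φ ε p - Φ ε q‖ ≤ κ' * (ρ + ε) * ‖p - q‖ := by
    filter_upwards [hlip, self_mem_nhdsWithin] with ε hlip hε ρ hρ p q hp hq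
    have hρε : 0 ≤ ρ + ε := add_nonneg ((norm_nonneg p).trans hp) (le_of_lt hε)
    refine (hlip ρ hρ p q hp hq).trans ?_
    gcongr
    linarith [norm_nonneg e]
  have hΦ0' : ∀ᶠ ε in 𝓝[>] 0, ‖Φ ε 0‖ ≤ κ' * ε := by
    filter_upwards [hΦ0, Ioo_mem_nhdsGT one_pos] with ε hΦ0 ⟨hε, hε1⟩
    refine (norm_le_mul_of_norm_sub_smul_le hε hε1.le hτ hC hΦ0).trans ?_
    gcongr
    linarith
  obtain ⟨ρ, hρ, hρρ₁, C', hC', hbranch⟩ := exists_fixedPoint_branch hS h0 (by positivity) hρ₁ hinv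
    hlip' hΦ0'
  refine ⟨ρ, hρ, hρρ₁, C' + C, by positivity, ?_⟩
  filter_upwards [hbranch, hΦ0, Ioo_mem_nhdsGT one_pos]
    with ε ⟨p, hpS, hp, hΦp, huniq, hbound⟩ hΦ0 ⟨hε, hε1⟩
  have hsq : ε ^ 2 ≤ ε ^ (1 + τ) := by
    rw [← Real.rpow_two]
    exact Real.rpow_le_rpow_of_exponent_ge hε hε1.le (by linarith)
  have hclose : ‖p - (ε : ℂ) • e‖ ≤ (C' + C) * ε ^ (1 + τ) :=
    calc ‖p - (ε : ℂ) • e‖ ≤ C' * ε ^ 2 + C * ε ^ (1 + τ) :=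
          (norm_sub_le_norm_sub_add_norm_sub _ _ _).trans (add_le_add hbound hΦ0)
      _ ≤ C' * ε ^ (1 + τ) + C * ε ^ (1 + τ) := by gcongr
      _ = (C' + C) * ε ^ (1 + τ) := by ring
  refine ⟨p, hpS, fun q => ⟨fun hq => huniq q hq.1 hq.2, ?_⟩,
    exists_eq_add_smul_of_norm_sub_le (Real.rpow_pos_of_pos hε _) hclose⟩
  rintro rfl
  exact ⟨hp, hΦp⟩

end FixedPoint

section LipschitzDeriv

variable {𝕜 V E F : Type*} [NontriviallyNormedField 𝕜] [NormedAddCommGroup V] [NormedSpace 𝕜 V]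
  [NormedAddCommGroup E] [NormedSpace 𝕜 E] [NormedAddCommGroup F] [NormedSpace 𝕜 F]

/-- Quantitative strict differentiability of `M` at `ω₀` with derivative `D`: on the closed ball of
radius `ρ ≤ r` about `ω₀`, the map `ω ↦ M ω - ω • D` is Lipschitz with constant `C * ρ`. -/
def HasLipschitzDerivAt (M : 𝕜 → V) (D : V) (ω₀ : 𝕜) (r C : ℝ) : Prop :=
  ∀ ρ ≤ r, ∀ ω₁ ∈ Metric.closedBall ω₀ ρ, ∀ ω₂ ∈ Metric.closedBall ω₀ ρ,
    ‖M ω₁ - M ω₂ - (ω₁ - ω₂) • D‖ ≤ C * ρ * ‖ω₁ - ω₂‖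

theorem HasLipschitzDerivAt.norm_sub_le {M : 𝕜 → V} {D : V} {ω₀ ω : 𝕜} {r C : ℝ}
    (hM : HasLipschitzDerivAt M D ω₀ r C) (hω : ω ∈ Metric.closedBall ω₀ r) :
    ‖M ω - M ω₀‖ ≤ (C * r + ‖D‖) * ‖ω - ω₀‖ := by
  have h := hM r le_rfl ω hω ω₀ (Metric.mem_closedBall_self (dist_nonneg.trans hω))
  calc ‖M ω - M ω₀‖ ≤ ‖M ω - M ω₀ - (ω - ω₀) • D‖ + ‖(ω - ω₀) • D‖ := by
        simpa using norm_add_le (M ω - M ω₀ - (ω - ω₀) • D) ((ω - ω₀) • D)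
    _ ≤ C * r * ‖ω - ω₀‖ + ‖ω - ω₀‖ * ‖D‖ := by gcongr; exact (norm_smul _ _).le
    _ = (C * r + ‖D‖) * ‖ω - ω₀‖ := by ring

theorem HasLipschitzDerivAt.continuousAt {M : 𝕜 → V} {D : V} {ω₀ : 𝕜} {r C : ℝ}
    (hM : HasLipschitzDerivAt M D ω₀ r C) (hr : 0 < r) : ContinuousAt M ω₀ :=
  continuousAt_of_locally_lipschitz hr (C * r + ‖D‖) fun ω hω => by
    simpa [dist_eq_norm] using hM.norm_sub_le hω.le

theorem norm_deriv_sub_deriv_le_of_differentiableOn_ball [NormedSpace ℂ V] [CompleteSpace V]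
    {h : ℂ → V} {a : ℂ} {δ c ρ : ℝ} (hδ : 0 < δ) (hd : DifferentiableOn ℂ h (Metric.ball a δ))
    (hc : ∀ z ∈ Metric.ball a δ, ‖h z‖ ≤ c) (hρ : ρ ≤ δ / 4) {y : ℂ}
    (hy : y ∈ Metric.closedBall a ρ) : ‖deriv h y - deriv h a‖ ≤ 8 * c / δ ^ 2 * ρ := by
  have hball : Metric.closedBall a ρ ⊆ Metric.ball a δ :=
    Metric.closedBall_subset_ball (by linarith)
  have hderiv₂ : ∀ y ∈ Metric.closedBall a ρ, ‖deriv (deriv h) y‖ ≤ 8 * c / δ ^ 2 := fun y hy => by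
    have hsub : Metric.closedBall y (δ / 2) ⊆ Metric.ball a δ := fun x hx => by
      have := dist_triangle x y a
      rw [Metric.mem_closedBall] at hx hy
      rw [Metric.mem_ball]
      linarith
    have hcauchy := Complex.norm_iteratedDeriv_le_of_forall_mem_sphere_norm_le 2 (half_pos hδ)
      ((hd.mono hsub).diffContOnCl_ball subset_rfl)
      fun x hx => hc x (hsub (Metric.sphere_subset_closedBall hx))
    rw [iteratedDeriv_succ, iteratedDeriv_one] at hcauchy
    refine hcauchy.trans_eq ?_
    norm_num
    ring
  have hdd : DifferentiableOn ℂ (deriv h) (Metric.ball a δ) := hd.deriv Metric.isOpen_ball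
  have hmean := (convex_closedBall a ρ).norm_image_sub_le_of_norm_deriv_le (𝕜 := ℂ)
    (fun x hx => hdd.differentiableAt (Metric.isOpen_ball.mem_nhds (hball hx))) hderiv₂
    (Metric.mem_closedBall_self (dist_nonneg.trans hy)) hy
  have hc0 : 0 ≤ c := (norm_nonneg _).trans (hc a (Metric.mem_ball_self hδ))
  exact hmean.trans (by gcongr; simpa [dist_eq_norm] using hy)

theorem hasLipschitzDerivAt_of_differentiableOn_ball [NormedSpace ℂ V] [CompleteSpace V]
    {h : ℂ → V} {a : ℂ} {δ c : ℝ} (hδ : 0 < δ) (hd : DifferentiableOn ℂ h (Metric.ball a δ))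
    (hc : ∀ z ∈ Metric.ball a δ, ‖h z‖ ≤ c) :
    HasLipschitzDerivAt h (deriv h a) a (δ / 4) (8 * c / δ ^ 2) := by
  intro ρ hρ z hz w hw
  have hderiv : ∀ y ∈ Metric.closedBall a ρ, HasDerivAt (fun y => h y - y • deriv h a)
      (deriv h y - (1 : ℂ) • deriv h a) y := fun y hy =>
    (hd.differentiableAt (Metric.isOpen_ball.mem_nhds
      (Metric.closedBall_subset_ball (by linarith) hy))).hasDerivAt.sub
        ((hasDerivAt_id y).smul_const _)
  have hmean := (convex_closedBall a ρ).norm_image_sub_le_of_norm_hasDerivWithin_le (𝕜 := ℂ)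
    (fun y hy => (hderiv y hy).hasDerivWithinAt)
    (fun y hy => by
      rw [one_smul]; exact norm_deriv_sub_deriv_le_of_differentiableOn_ball hδ hd hc hρ hy) hw hz
  rwa [sub_sub_sub_comm, ← sub_smul] at hmean

/-- The second order remainder `M (ω₀ + μ) (e + u) - M ω₀ (e + u) - μ D e`, as a function of
`p = (u, μ)`, of a family `M` of operators with derivative `D` at `ω₀`. -/
def secondOrderRemainder (M : 𝕜 → E →L[𝕜] F) (D : E →L[𝕜] F) (ω₀ : 𝕜) (e : E) (p : E × 𝕜) : F :=
  (M (ω₀ + p.2) - M ω₀) (e + p.1) - p.2 • D e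

theorem secondOrderRemainder_zero (M : 𝕜 → E →L[𝕜] F) (D : E →L[𝕜] F) (ω₀ : 𝕜) (e : E) :
    secondOrderRemainder M D ω₀ e 0 = 0 := by
  simp [secondOrderRemainder]

theorem HasLipschitzDerivAt.norm_secondOrderRemainder_sub_le {M : 𝕜 → E →L[𝕜] F}
    {D : E →L[𝕜] F} {ω₀ : 𝕜} {r C ρ : ℝ} (hM : HasLipschitzDerivAt M D ω₀ r C) (hC : 0 ≤ C)
    (hρ : ρ ≤ r) (e : E) {p q : E × 𝕜} (hp : ‖p‖ ≤ ρ) (hq : ‖q‖ ≤ ρ) :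
    ‖secondOrderRemainder M D ω₀ e p - secondOrderRemainder M D ω₀ e q‖
      ≤ (C * (‖e‖ + 2 * r) + 2 * ‖D‖) * ρ * ‖p - q‖ := by
  obtain ⟨hp₁, hp₂⟩ := norm_prod_le_iff.1 hp
  obtain ⟨-, hq₂⟩ := norm_prod_le_iff.1 hq
  obtain ⟨hpq₁, hpq₂⟩ := norm_prod_le_iff.1 (le_refl ‖p - q‖)
  have hρ0 : 0 ≤ ρ := (norm_nonneg p).trans hp
  have hmem : ∀ {s : ℝ} {μ : 𝕜}, ‖μ‖ ≤ s → ω₀ + μ ∈ Metric.closedBall ω₀ s := fun hμ => by simpa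
  have hsplit : secondOrderRemainder M D ω₀ e p - secondOrderRemainder M D ω₀ e q
      = (M (ω₀ + p.2) - M (ω₀ + q.2) - (p.2 - q.2) • D) (e + p.1) + (p.2 - q.2) • D p.1
        + (M (ω₀ + q.2) - M ω₀) (p.1 - q.1) := by
    simp only [secondOrderRemainder, sub_apply, smul_apply, map_add, map_sub]
    module
  have hfirst : ‖(M (ω₀ + p.2) - M (ω₀ + q.2) - (p.2 - q.2) • D) (e + p.1)‖
      ≤ C * ρ * ‖p - q‖ * (‖e‖ + r) := by
    refine ((M (ω₀ + p.2) - M (ω₀ + q.2) - (p.2 - q.2) • D).le_opNorm _).trans ?_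
    gcongr
    · have h := hM ρ hρ _ (hmem hp₂) _ (hmem hq₂)
      rw [add_sub_add_left_eq_sub] at h
      exact h.trans (by gcongr; exact hpq₂)
    · exact (norm_add_le _ _).trans (by gcongr; exact hp₁.trans hρ)
  have hsecond : ‖(p.2 - q.2) • D p.1‖ ≤ ‖p - q‖ * (‖D‖ * ρ) := by
    rw [norm_smul]
    gcongr
    · exact hpq₂
    · exact D.le_opNorm_of_le hp₁
  have hthird : ‖(M (ω₀ + q.2) - M ω₀) (p.1 - q.1)‖ ≤ (C * r + ‖D‖) * ρ * ‖p - q‖ := by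
    refine ContinuousLinearMap.le_of_opNorm_le_of_le _ ?_ hpq₁
    refine (hM.norm_sub_le (hmem (hq₂.trans hρ))).trans ?_
    rw [add_sub_cancel_left]
    have : 0 ≤ r := hρ0.trans hρ
    gcongr
  rw [hsplit]
  refine (norm_add₃_le.trans (add_le_add_three hfirst hsecond hthird)).trans_eq ?_
  ring

end LipschitzDeriv

section GraphDomain

variable {𝕜 E F : Type*} [NontriviallyNormedField 𝕜] [NormedAddCommGroup E] [NormedSpace 𝕜 E]
  [NormedAddCommGroup F] [NormedSpace 𝕜 F]

/-- The domain of an unbounded operator `T`, normed by the graph norm `‖u‖ + ‖T u‖`. It is a type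
synonym, since `T.domain` already carries the norm of the ambient space. -/
def GraphDomain (T : E →ₗ.[𝕜] F) : Type _ := T.domain

namespace GraphDomain

variable {T : E →ₗ.[𝕜] F}

instance : AddCommGroup (GraphDomain T) := inferInstanceAs (AddCommGroup T.domain)

instance : Module 𝕜 (GraphDomain T) := inferInstanceAs (Module 𝕜 T.domain)

/-- The identification of the domain of `T` with the normed space `GraphDomain T`. -/
def mk : T.domain ≃ₗ[𝕜] GraphDomain T := LinearEquiv.refl 𝕜 T.domain

instance : NormedAddCommGroup (GraphDomain T) :=
  AddGroupNorm.toNormedAddCommGroup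
    { toFun := fun u => ‖(mk.symm u : E)‖ + ‖T (mk.symm u)‖
      map_zero' := by simp
      add_le' := fun u v => by
        rw [map_add, Submodule.coe_add, T.map_add]
        linarith [norm_add_le (mk.symm u : E) (mk.symm v),
          norm_add_le (T (mk.symm u)) (T (mk.symm v))]
      neg' := fun u => by rw [map_neg, Submodule.coe_neg, T.map_neg, norm_neg, norm_neg]
      eq_zero_of_map_eq_zero' := fun u hu => by
        have h : ‖(mk.symm u : E)‖ = 0 := by
          linarith [norm_nonneg (mk.symm u : E), norm_nonneg (T (mk.symm u))]
        simpa using h }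

theorem norm_def (u : GraphDomain T) : ‖u‖ = ‖(mk.symm u : E)‖ + ‖T (mk.symm u)‖ := rfl

instance : NormedSpace 𝕜 (GraphDomain T) where
  norm_smul_le c u := by
    rw [norm_def, norm_def, map_smul, Submodule.coe_smul, T.map_smul, norm_smul, norm_smul, mul_add]

variable (T) in
/-- The embedding of the domain of `T` into the ambient space. -/
def incl : GraphDomain T →L[𝕜] E :=
  (T.domain.subtype ∘ₗ mk.symm.toLinearMap).mkContinuous 1 fun u => by
    rw [one_mul, norm_def]
    exact le_add_of_nonneg_right (norm_nonneg _)

variable (T) in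
/-- The operator `T`, which is bounded for the graph norm. -/
def op : GraphDomain T →L[𝕜] F :=
  (T.toFun ∘ₗ mk.symm.toLinearMap).mkContinuous 1 fun u => by
    rw [one_mul, norm_def]
    exact le_add_of_nonneg_left (norm_nonneg _)

theorem norm_incl_le (u : GraphDomain T) : ‖incl T u‖ ≤ ‖u‖ :=
  le_add_of_nonneg_right (norm_nonneg _)

theorem completeSpace [CompleteSpace E] [CompleteSpace F] (hT : T.IsClosed) :
    CompleteSpace (GraphDomain T) := by
  have hanti : AntilipschitzWith 2 ((incl T).prod (op T)) :=
    AddMonoidHomClass.antilipschitz_of_bound _ fun u => by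
      have h := norm_prod_le_iff.1 (le_refl ‖(incl T).prod (op T) u‖)
      exact (add_le_add h.1 h.2).trans_eq (by push_cast; ring)
  have hrange : range ((incl T).prod (op T)) = T.graph := by
    ext ⟨x, y⟩
    simp only [mem_range, SetLike.mem_coe, LinearPMap.mem_graph_iff]
    exact ⟨fun ⟨u, hu⟩ => ⟨mk.symm u, Prod.mk.inj hu⟩,
      fun ⟨u, hx, hy⟩ => ⟨mk u, Prod.ext hx hy⟩⟩
  rw [completeSpace_iff_isComplete_range
    (hanti.isUniformInducing ((incl T).prod (op T)).uniformContinuous), hrange]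
  exact IsClosed.isComplete hT

end GraphDomain

end GraphDomain

section Symmetry

theorem ae_comp_neg {p : Rd d → Prop} (h : ∀ᵐ x, p x) : ∀ᵐ x, p (-x) :=
  (Measure.measurePreserving_neg volume).quasiMeasurePreserving.ae h

theorem PT_add (u v : L2 d) : PT (u + v) = PT u + PT v := by
  apply Lp.ext
  filter_upwards [coeFn_PT (u + v), coeFn_PT u, coeFn_PT v, Lp.coeFn_add (PT u) (PT v),
    ae_comp_neg (Lp.coeFn_add u v)] with x huv hu hv hPT hadd
  rw [huv, hPT, Pi.add_apply, hu, hv, hadd, Pi.add_apply, map_add]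

theorem PT_smul (c : ℂ) (u : L2 d) : PT (c • u) = conj c • PT u := by
  apply Lp.ext
  filter_upwards [coeFn_PT (c • u), coeFn_PT u, Lp.coeFn_smul (conj c) (PT u),
    ae_comp_neg (Lp.coeFn_smul c u)] with x hcu hu hPT hsmul
  rw [hcu, hPT, Pi.smul_apply, hu, hsmul, Pi.smul_apply, smul_eq_mul, smul_eq_mul, map_mul]

theorem norm_PT (u : L2 d) : ‖PT u‖ = ‖u‖ := by
  have h : eLpNorm (ptFun u) 2 volume = eLpNorm (fun x => u (-x)) 2 volume :=
    eLpNorm_congr_norm_ae (.of_forall fun x => by simp [ptFun])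
  rw [PT, Lp.norm_toLp, Lp.norm_def, h]
  exact congrArg ENNReal.toReal (eLpNorm_comp_measurePreserving (Lp.aestronglyMeasurable u)
    (Measure.measurePreserving_neg volume))

/-- `PT` as an antilinear isometry of `L²`. -/
def ptLinearIsometry : L2 d →ₗᵢ⋆[ℂ] L2 d where
  toFun := PT
  map_add' := PT_add
  map_smul' := PT_smul
  norm_map' := norm_PT

theorem PT_sub (u v : L2 d) : PT (u - v) = PT u - PT v := map_sub ptLinearIsometry u v

theorem PT_zero : PT (0 : L2 d) = 0 := map_zero ptLinearIsometry

theorem continuous_PT : Continuous (PT : L2 d → L2 d) := ptLinearIsometry.continuous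

end Symmetry

section MulOp

variable {w w₁ w₂ : Rd d → ℂ}

theorem norm_mulOp_le (hw : MemLp w ∞ volume) {c : ℝ} (hc : 0 ≤ c) (h : ∀ᵐ x, ‖w x‖ ≤ c) :
    ‖mulOp w‖ ≤ c := by
  refine ContinuousLinearMap.opNorm_le_bound _ hc fun u => ?_
  apply Lp.norm_le_mul_norm_of_ae_le_mul
  filter_upwards [coeFn_mulOp hw u, h] with x hx hwx
  rw [hx, norm_mul]
  gcongr

theorem mulOp_sub (h₁ : MemLp w₁ ∞ volume) (h₂ : MemLp w₂ ∞ volume) :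
    mulOp (w₁ - w₂) = mulOp w₁ - mulOp w₂ := by
  ext1 u
  apply Lp.ext
  rw [sub_apply]
  filter_upwards [coeFn_mulOp (h₁.sub h₂) u, coeFn_mulOp h₁ u, coeFn_mulOp h₂ u,
    Lp.coeFn_sub (mulOp w₁ u) (mulOp w₂ u)] with x hx hx₁ hx₂ hsub
  rw [hsub, Pi.sub_apply, hx₁, hx₂, ← sub_mul, hx, Pi.sub_apply]

theorem mulOp_const_smul (hw : MemLp w ∞ volume) (c : ℂ) : mulOp (c • w) = c • mulOp w := by
  ext1 u
  apply Lp.ext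
  rw [smul_apply]
  filter_upwards [coeFn_mulOp (hw.const_smul c) u, coeFn_mulOp hw u,
    Lp.coeFn_smul c (mulOp w u)] with x hx hx₁ hsmul
  rw [hsmul, Pi.smul_apply, hx₁, hx, Pi.smul_apply, smul_eq_mul, smul_eq_mul, mul_assoc]

theorem PT_mulOp (hw : MemLp w ∞ volume) (hPT : PTFunction w) (u : L2 d) :
    PT (mulOp w u) = mulOp w (PT u) := by
  apply Lp.ext
  filter_upwards [coeFn_PT (mulOp w u), coeFn_mulOp hw (PT u), coeFn_PT u, hPT,
    ae_comp_neg (coeFn_mulOp hw u)] with x hx hx₁ hu hwx hneg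
  rw [hx, hx₁, hu, hneg, map_mul, hwx]

end MulOp

section Potential

theorem ae_norm_le_of_eLpNorm_top_le {X E : Type*} [MeasurableSpace X] [NormedAddCommGroup E]
    {μ : Measure X} {h : X → E} {c : ℝ} (hc : 0 ≤ c) (hh : eLpNorm h ∞ μ ≤ ENNReal.ofReal c) :
    ∀ᵐ x ∂μ, ‖h x‖ ≤ c := by
  rw [eLpNorm_exponent_top] at hh
  filter_upwards [ae_le_eLpNormEssSup (f := h) (μ := μ)] with x hx
  rw [← ENNReal.ofReal_le_ofReal_iff hc, ofReal_norm]
  exact hx.trans hh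

theorem exists_seq_tendsto_slope (a : ℂ) {δ : ℝ} (hδ : 0 < δ) :
    ∃ s : ℕ → ℝ, (∀ n, s n ∈ Ioo 0 δ) ∧ ∀ h : ℂ → ℂ, DifferentiableAt ℂ h a →
      Tendsto (fun n => slope h a (a + s n)) atTop (𝓝 (deriv h a)) := by
  obtain ⟨s, -, hs, hs0⟩ := exists_seq_strictAnti_tendsto' hδ
  refine ⟨s, hs, fun h hh => (hasDerivAt_iff_tendsto_slope.1 hh.hasDerivAt).comp
    (tendsto_nhdsWithin_iff.2 ⟨?_, .of_forall fun n => ?_⟩)⟩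
  · exact ((Complex.continuous_ofReal.const_add a).tendsto' 0 a (by simp)).comp hs0
  · simpa using (hs n).1.ne'

variable {W : Rd d → ℂ → ℂ} {δ : ℝ}

theorem add_ofReal_mem_ball {a : ℂ} {s : ℝ} (hs : s ∈ Ioo 0 δ) : a + s ∈ Metric.ball a δ := by
  simpa [abs_of_pos hs.1] using hs.2

theorem ptFunction_deriv {ω₀ : ℝ} (hδ : 0 < δ)
    (hW : ∀ᵐ x, DifferentiableAt ℂ (W x) ω₀)
    (hPT : ∀ ω : ℝ, |ω - ω₀| < δ → PTFunction fun x => W x ω) :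
    PTFunction fun x => deriv (W x) ω₀ := by
  obtain ⟨s, hs, hslope⟩ := exists_seq_tendsto_slope ω₀ hδ
  have hPTs : ∀ᵐ x, ∀ n, conj (W (-x) (ω₀ + s n)) = W x (ω₀ + s n) := ae_all_iff.2 fun n => by
    simpa [PTFunction] using hPT (ω₀ + s n) (by simpa [abs_of_pos (hs n).1] using (hs n).2)
  filter_upwards [hW, ae_comp_neg hW, hPTs, hPT ω₀ (by simpa)] with x hx hxneg hPTx hPTx₀
  refine tendsto_nhds_unique
    ((Complex.continuous_conj.tendsto _).comp (hslope _ hxneg)) ((hslope _ hx).congr fun n => ?_)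
  simp [slope_def_field, hPTx n, hPTx₀]

namespace AssumptionW

variable {ω₀ : ℂ} (hW : AssumptionW W ω₀ δ)

include hW

theorem memLp {ω : ℂ} (hω : ω ∈ Metric.ball ω₀ δ) : MemLp (fun x => W x ω) ∞ volume :=
  let ⟨_, h⟩ := hW.bounded
  (h ω hω).1

theorem ae_differentiableAt (hδ : 0 < δ) : ∀ᵐ x, DifferentiableAt ℂ (W x) ω₀ :=
  hW.holomorphic.mono fun _ hx => hx.differentiableAt (Metric.ball_mem_nhds ω₀ hδ)

theorem ae_norm_le : ∃ c : ℝ, 0 ≤ c ∧ ∀ᵐ x, ∀ ω ∈ Metric.ball ω₀ δ, ‖W x ω‖ ≤ c := by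
  -- The exceptional null set is made independent of `ω` on a countable dense set, by continuity.
  obtain ⟨c, hc⟩ := hW.bounded
  obtain ⟨D, hD, hdense⟩ := TopologicalSpace.exists_countable_dense ℂ
  have hcount : ∀ᵐ x, ∀ ω ∈ D ∩ Metric.ball ω₀ δ, ‖W x ω‖ ≤ max c 0 := by
    rw [ae_ball_iff (hD.mono inter_subset_left)]
    exact fun ω hω => ae_norm_le_of_eLpNorm_top_le (le_max_right _ _)
      ((hc ω hω.2).2.trans (ENNReal.ofReal_le_ofReal (le_max_left _ _)))
  refine ⟨max c 0, le_max_right _ _, ?_⟩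
  filter_upwards [hcount, hW.holomorphic] with x hx hholo ω hω
  have hcl : ω ∈ closure (Metric.ball ω₀ δ ∩ D) :=
    hdense.open_subset_closure_inter Metric.isOpen_ball hω
  have hcont : ContinuousWithinAt (fun ω => ‖W x ω‖) (Metric.ball ω₀ δ ∩ D) ω :=
    ((hholo.continuousOn ω hω).mono inter_subset_left).norm
  exact hcont.closure_le hcl continuousWithinAt_const fun y hy => hx y ⟨hy.2, hy.1⟩

theorem aestronglyMeasurable_deriv (hδ : 0 < δ) :
    AEStronglyMeasurable (fun x => deriv (W x) ω₀) volume := by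
  obtain ⟨s, hs, hslope⟩ := exists_seq_tendsto_slope ω₀ hδ
  refine aestronglyMeasurable_of_tendsto_ae atTop
    (f := fun n x => slope (W x) ω₀ (ω₀ + s n)) (fun n => ?_)
    ((hW.ae_differentiableAt hδ).mono fun x hx => hslope (W x) hx)
  exact ((hW.memLp (add_ofReal_mem_ball (hs n))).aestronglyMeasurable.sub
    (hW.memLp (Metric.mem_ball_self hδ)).aestronglyMeasurable).const_smul (ω₀ + s n - ω₀)⁻¹

theorem memLp_deriv (hδ : 0 < δ) : MemLp (fun x => deriv (W x) ω₀) ∞ volume := by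
  obtain ⟨c, -, hc⟩ := hW.ae_norm_le
  refine memLp_top_of_bound (hW.aestronglyMeasurable_deriv hδ) (c / (δ / 2)) ?_
  filter_upwards [hc, hW.holomorphic] with x hx hholo
  have hsub : Metric.closedBall ω₀ (δ / 2) ⊆ Metric.ball ω₀ δ :=
    Metric.closedBall_subset_ball (by linarith)
  exact Complex.norm_deriv_le_of_forall_mem_sphere_norm_le (half_pos hδ)
    ((hholo.mono hsub).diffContOnCl_ball subset_rfl) fun y hy =>
      hx y (hsub (Metric.sphere_subset_closedBall hy))

theorem hasLipschitzDerivAt_mulOp (hδ : 0 < δ) : ∃ C : ℝ, 0 ≤ C ∧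
    HasLipschitzDerivAt (fun ω => mulOp fun x => W x ω) (mulOp fun x => deriv (W x) ω₀) ω₀
      (δ / 4) C := by
  obtain ⟨c, hc0, hc⟩ := hW.ae_norm_le
  refine ⟨8 * c / δ ^ 2, by positivity, fun ρ hρ ω₁ h₁ ω₂ h₂ => ?_⟩
  have hsub : Metric.closedBall ω₀ ρ ⊆ Metric.ball ω₀ δ :=
    Metric.closedBall_subset_ball (by linarith)
  have hm₁ := hW.memLp (hsub h₁)
  have hm₂ := hW.memLp (hsub h₂)
  have hD := (hW.memLp_deriv hδ).const_smul (ω₁ - ω₂)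
  rw [← mulOp_sub hm₁ hm₂, ← mulOp_const_smul (hW.memLp_deriv hδ), ← mulOp_sub (hm₁.sub hm₂) hD]
  have hρ0 : 0 ≤ ρ := dist_nonneg.trans h₁
  refine norm_mulOp_le ((hm₁.sub hm₂).sub hD) (by positivity) ?_
  filter_upwards [hc, hW.holomorphic] with x hx hholo
  exact hasLipschitzDerivAt_of_differentiableOn_ball hδ hholo hx ρ hρ ω₁ h₁ ω₂ h₂

end AssumptionW

end Potential

section Linearization

/-- The nondegeneracy of the linear problem at `ω₀` from which the branch is constructed: a
geometrically simple eigenvalue with closed range, adjoint to `φs`, which is a limit of parameters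
`ω` at which `0` is in the resolvent set of `L(·, ω)`. -/
structure SimpleEigenvalue (A : Op d) (W : Rd d → ℂ → ℂ) (ω₀ : ℂ) (φ₀ : A.domain) (φs : L2 d) :
    Prop where
  dense : Dense (A.domain : Set (L2 d))
  closed : A.IsClosed
  ker : ∀ u : (opL A W ω₀).domain, opL A W ω₀ u = 0 ↔ ∃ c : ℂ, (u : L2 d) = c • (φ₀ : L2 d)
  closed_range : IsClosed (Set.range fun u : (opL A W ω₀).domain => opL A W ω₀ u)
  mem_closure : ω₀ ∈ closure {ω | InResolventSet (opL A W ω) 0}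
  adjoint_ker : ∃ h : φs ∈ (opL A W ω₀).adjoint.domain, (opL A W ω₀).adjoint ⟨φs, h⟩ = 0
  inner_one : inner ℂ φs (φ₀ : L2 d) = 1

open GraphDomain in
/-- `L(·, ω) = A - W(·, ω)` as a bounded operator on the domain of `A` with its graph norm. -/
def linearization (A : Op d) (W : Rd d → ℂ → ℂ) (ω : ℂ) : GraphDomain A →L[ℂ] L2 d :=
  op A - (mulOp fun x => W x ω) ∘L incl A

/-- The functional `u ↦ ⟨u, φs⟩` on the domain of `A`. -/
def pairing (A : Op d) (φs : L2 d) : GraphDomain A →L[ℂ] ℂ := innerSL ℂ φs ∘L GraphDomain.incl A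

/-- The linearization of the constrained problem at `(ω₀, 0)`, with unknowns in the domain of `A`
and in `ℂ`: it borders `L(·, ω₀)` by `∂_ω W(·, ω₀) φ₀` and by the pairing with `φs`. -/
def borderedLinearization (A : Op d) (W : Rd d → ℂ → ℂ) (ω₀ : ℂ) (φ₀ : A.domain) (φs : L2 d) :
    GraphDomain A × ℂ →L[ℂ] L2 d × ℂ :=
  bordered (linearization A W ω₀) (mulOp (fun x => deriv (W x) ω₀) φ₀) (pairing A φs)

variable {A : Op d} {W : Rd d → ℂ → ℂ} {ω₀ : ℂ} {φ₀ : A.domain} {φs : L2 d} {δ : ℝ}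

open GraphDomain (mk)

theorem Isolated.mem_closure (h : Isolated A W ω₀) :
    ω₀ ∈ closure {ω | InResolventSet (opL A W ω) 0} := by
  obtain ⟨ρ, hρ, hiso⟩ := h
  rw [mem_closure_iff_frequently]
  have hev : ∀ᶠ ω in 𝓝[≠] ω₀, InResolventSet (opL A W ω) 0 := by
    filter_upwards [self_mem_nhdsWithin, mem_nhdsWithin_of_mem_nhds (Metric.ball_mem_nhds ω₀ hρ)]
      with ω hne hball
    exact not_not.1 fun h => hne ((hiso ω hball).1 h)
  exact hev.frequently.filter_mono nhdsWithin_le_nhds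

theorem SimpleEigenvalue.of_isolated (hA : AssumptionA A) (hsimple : AlgebraicallySimple A W ω₀ φ₀)
    (hisol : Isolated A W ω₀) (hnorm : Normalized A W ω₀ φ₀ φs) :
    SimpleEigenvalue A W ω₀ φ₀ φs where
  dense := hA.dense
  closed := hA.closed
  ker := hsimple.ker
  closed_range := hsimple.closed_range
  mem_closure := hisol.mem_closure
  adjoint_ker := hnorm.adjoint_ker
  inner_one := hnorm.inner_one

theorem linearization_surjective {ω : ℂ} (h : InResolventSet (opL A W ω) 0) :
    Function.Surjective (linearization A W ω) := fun y => by
  obtain ⟨R, hR, -⟩ := h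
  obtain ⟨hdom, hy⟩ := hR (-y)
  refine ⟨mk ⟨R (-y), hdom⟩, ?_⟩
  rw [zero_smul, zero_sub, neg_inj] at hy
  exact hy

theorem continuousAt_linearization (hδ : 0 < δ) (hW : AssumptionW W ω₀ δ) :
    ContinuousAt (linearization A W) ω₀ := by
  obtain ⟨C, -, hC⟩ := hW.hasLipschitzDerivAt_mulOp hδ
  exact continuousAt_const.sub
    ((hC.continuousAt (by positivity)).clm_comp continuousAt_const)

theorem linearization_mem_closure_surjective (hδ : 0 < δ) (hW : AssumptionW W ω₀ δ)
    (h : ω₀ ∈ closure {ω | InResolventSet (opL A W ω) 0}) :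
    linearization A W ω₀ ∈ closure {S : GraphDomain A →L[ℂ] L2 d | Function.Surjective S} :=
  closure_mono (image_subset_iff.2 fun _ => linearization_surjective)
    (mem_closure_image (continuousAt_linearization hδ hW) h)

theorem Transversal.inner_mulOp_deriv_ne_zero {u v : L2 d} (h : Transversal W ω₀ u v)
    (hD : MemLp (fun x => deriv (W x) ω₀) ∞ volume) :
    inner ℂ v (mulOp (fun x => deriv (W x) ω₀) u) ≠ 0 := by
  rw [L2.inner_def]
  refine ne_of_eq_of_ne (integral_congr_ae ?_) h
  filter_upwards [coeFn_mulOp hD u] with x hx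
  rw [hx, RCLike.inner_apply]

namespace SimpleEigenvalue

variable (h : SimpleEigenvalue A W ω₀ φ₀ φs)

include h

theorem pairing_mk : pairing A φs (GraphDomain.mk φ₀) = 1 := h.inner_one

theorem ker_linearization : (linearization A W ω₀).ker = ℂ ∙ GraphDomain.mk φ₀ := by
  ext u
  rw [Submodule.mem_span_singleton]
  refine (h.ker (GraphDomain.mk.symm u)).trans (exists_congr fun c => ?_)
  exact ⟨fun hc => Subtype.ext hc.symm, fun hc => congrArg (GraphDomain.incl A) hc.symm⟩

theorem mem_orthogonal_range : φs ∈ (linearization A W ω₀).rangeᗮ := by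
  rw [Submodule.mem_orthogonal']
  rintro _ ⟨u, rfl⟩
  obtain ⟨hdom, hzero⟩ := h.adjoint_ker
  have hadj := LinearPMap.adjoint_isFormalAdjoint (T := opL A W ω₀) h.dense ⟨φs, hdom⟩
    (GraphDomain.mk.symm u)
  rw [hzero, inner_zero_left] at hadj
  exact hadj.symm

theorem range_linearization (hδ : 0 < δ) (hW : AssumptionW W ω₀ δ) :
    (linearization A W ω₀).range = (ℂ ∙ φs)ᗮ := by
  have hcomplete := GraphDomain.completeSpace h.closed
  refine range_eq_orthogonal_span_singleton h.ker_linearization h.pairing_mk h.closed_range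
    h.mem_orthogonal_range ?_ (linearization_mem_closure_surjective hδ hW h.mem_closure)
  rintro rfl
  simpa using h.inner_one

theorem exists_solutionOperator (hδ : 0 < δ) (hW : AssumptionW W ω₀ δ)
    (hWt : Transversal W ω₀ φ₀ φs) : ∃ T : L2 d →L[ℂ] GraphDomain A × ℂ,
      ∀ y p, borderedLinearization A W ω₀ φ₀ φs p = (y, 0) ↔ p = T y := by
  have hcomplete := GraphDomain.completeSpace h.closed
  have hrange : (linearization A W ω₀).range = (innerSL ℂ φs).ker := by
    rw [h.range_linearization hδ hW]
    exact Submodule.ext fun y => Submodule.mem_orthogonal_singleton_iff_inner_right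
  let B := ContinuousLinearEquiv.ofBijective (borderedLinearization A W ω₀ φ₀ φs)
    (ker_bordered_eq_bot h.ker_linearization h.pairing_mk hrange.le
      (hWt.inner_mulOp_deriv_ne_zero (hW.memLp_deriv hδ)))
    (range_bordered_eq_top (apply_eq_zero_of_ker_eq_span h.ker_linearization) h.pairing_mk
      hrange.ge (hWt.inner_mulOp_deriv_ne_zero (hW.memLp_deriv hδ)))
  exact ⟨B.symm ∘L ContinuousLinearMap.inl ℂ (L2 d) ℂ, fun y p => B.eq_symm_apply.symm⟩

end SimpleEigenvalue

end Linearization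

section LinearSymmetry

variable {A : Op d} {W : Rd d → ℂ → ℂ} {φ₀ : A.domain} {φs : L2 d} {ω₀ δ : ℝ}

open GraphDomain (mk incl op)

theorem exists_phase_PT_eq {u : L2 d} {a : ℂ} (hu : u ≠ 0) (ha : PT u = a • u) :
    ∃ c : ℂ, ‖c‖ = 1 ∧ PT (c • u) = c • u := by
  have hnorm : ‖a‖ = 1 := by
    have := norm_PT u
    rw [ha, norm_smul] at this
    exact mul_right_cancel₀ (norm_ne_zero_iff.2 hu) (this.trans (one_mul _).symm)
  obtain ⟨c, rfl⟩ := IsAlgClosed.exists_pow_nat_eq a two_pos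
  have hc : ‖c‖ = 1 := by
    rw [norm_pow] at hnorm
    exact (pow_eq_one_iff_of_nonneg (norm_nonneg c) two_ne_zero).1 hnorm
  refine ⟨c, hc, ?_⟩
  rw [PT_smul, ha, smul_smul, pow_two, ← mul_assoc, Complex.conj_mul', hc]
  simp

theorem exists_linearization_eq_PT (hA : PTOperator A) (hW : MemLp (fun x => W x ω₀) ∞ volume)
    (hPT : PTFunction fun x => W x ω₀) (u : GraphDomain A) :
    ∃ v, incl A v = PT (incl A u) ∧ linearization A W ω₀ v = PT (linearization A W ω₀ u) := by
  obtain ⟨hdom, hAPT⟩ := hA (mk.symm u)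
  refine ⟨mk ⟨_, hdom⟩, rfl, ?_⟩
  have hsub : linearization A W ω₀ u = A (mk.symm u) - mulOp (fun x => W x ω₀) (mk.symm u) := rfl
  rw [hsub, PT_sub, PT_mulOp hW hPT, ← hAPT]
  rfl

theorem SimpleEigenvalue.inner_PT (h : SimpleEigenvalue A W ω₀ φ₀ φs) (hδ : 0 < δ)
    (hW : AssumptionW W ω₀ δ) (hA : PTOperator A) (hPTW : PTFunction fun x => W x ω₀)
    (hφ₀ : PT (φ₀ : L2 d) = φ₀) (y : L2 d) : inner ℂ φs (PT y) = conj (inner ℂ φs y) := by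
  set w := y - inner ℂ φs y • (φ₀ : L2 d) with hw
  have hmem : ∀ z, z ∈ (linearization A W ω₀).range ↔ inner ℂ φs z = 0 := fun z => by
    rw [h.range_linearization hδ hW, Submodule.mem_orthogonal_singleton_iff_inner_right]
  obtain ⟨u, hu⟩ := (hmem w).2 (by simp [hw, inner_sub_right, inner_smul_right, h.inner_one])
  obtain ⟨v, -, hv⟩ := exists_linearization_eq_PT hA (hW.memLp (Metric.mem_ball_self hδ)) hPTW u
  have hPTw : inner ℂ φs (PT w) = 0 := (hmem _).1 ⟨v, hv.trans (congrArg PT hu)⟩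
  rw [hw, PT_sub, PT_smul, hφ₀, inner_sub_right, inner_smul_right, h.inner_one, mul_one,
    sub_eq_zero] at hPTw
  exact hPTw

/-- Pairs of a `PT`-symmetric element of the domain of `A` and a real parameter. -/
def symmetricPairs (A : Op d) : Set (GraphDomain A × ℂ) :=
  {p | PT (incl A p.1) = incl A p.1 ∧ conj p.2 = p.2}

theorem isClosed_symmetricPairs : IsClosed (symmetricPairs A) := by
  have hincl : Continuous fun p : GraphDomain A × ℂ => incl A p.1 :=
    (incl A).continuous.comp continuous_fst
  exact (isClosed_eq (continuous_PT.comp hincl) hincl).inter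
    (isClosed_eq (Complex.continuous_conj.comp continuous_snd) continuous_snd)

theorem zero_mem_symmetricPairs : (0 : GraphDomain A × ℂ) ∈ symmetricPairs A := by
  simp [symmetricPairs, PT_zero]

theorem SimpleEigenvalue.solutionOperator_mem_symmetricPairs (h : SimpleEigenvalue A W ω₀ φ₀ φs)
    (hδ : 0 < δ) (hW : AssumptionW W ω₀ δ) (hA : PTOperator A)
    (hPTW : ∀ ω : ℝ, |ω - ω₀| < δ → PTFunction fun x => W x ω) (hφ₀ : PT (φ₀ : L2 d) = φ₀)
    {T : L2 d →L[ℂ] GraphDomain A × ℂ}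
    (hT : ∀ y p, borderedLinearization A W ω₀ φ₀ φs p = (y, 0) ↔ p = T y) {y : L2 d}
    (hy : PT y = y) : T y ∈ symmetricPairs A := by
  -- `(PT u, conj μ)` solves the same bordered system as `(u, μ)`.
  have hPTW₀ : PTFunction fun x => W x ω₀ := hPTW ω₀ (by simpa)
  have hb : PT (mulOp (fun x => deriv (W x) ω₀) φ₀) = mulOp (fun x => deriv (W x) ω₀) φ₀ := by
    rw [PT_mulOp (hW.memLp_deriv hδ) (ptFunction_deriv hδ (hW.ae_differentiableAt hδ) hPTW), hφ₀]
  have hp := (hT y (T y)).2 rfl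
  rw [borderedLinearization, bordered_apply] at hp
  obtain ⟨h₁, h₂⟩ := Prod.mk.inj hp
  obtain ⟨v, hv, hLv⟩ :=
    exists_linearization_eq_PT hA (hW.memLp (Metric.mem_ball_self hδ)) hPTW₀ (T y).1
  have heq : (v, conj (T y).2) = T y := (hT y _).1 <| by
    rw [borderedLinearization, bordered_apply]
    refine Prod.ext ?_ ?_
    · rw [hLv]
      simpa only [PT_sub, PT_smul, hb, hy] using congrArg PT h₁
    · change inner ℂ φs (incl A v) = 0
      rw [hv, h.inner_PT hδ hW hA hPTW₀ hφ₀]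
      exact (congrArg conj h₂).trans (map_zero _)
  exact ⟨by rw [← hv, ← heq], congrArg Prod.snd heq⟩

end LinearSymmetry

section Superposition

/-- The class in `L²` of a function (and `0` if the function is not in `L²`). -/
def toL2 (h : Rd d → ℂ) : L2 d :=
  open Classical in if hh : MemLp h 2 volume then hh.toLp h else 0

/-- The superposition operator `u ↦ f(·, ω, u)` on `L²`. -/
def superposition (f : Rd d → ℂ → ℂ → ℂ) (ω : ℂ) (u : L2 d) : L2 d := toL2 fun x => f x ω (u x)

/-- The rescaled nonlinearity `u ↦ t⁻¹ f(·, ω, t u)`. -/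
def rescaled (f : Rd d → ℂ → ℂ → ℂ) (t : ℝ) (ω : ℂ) (u : L2 d) : L2 d :=
  (t : ℂ)⁻¹ • superposition f ω ((t : ℂ) • u)

/-- The leading order term `g |u|^{1/α} u` of the nonlinearity. -/
def leadingTerm (g : Rd d → ℂ) (α : ℝ) (u : L2 d) : L2 d :=
  toL2 fun x => g x * ((‖u x‖ ^ (1 / α) : ℝ) : ℂ) * u x

variable {f : Rd d → ℂ → ℂ → ℂ}

theorem coeFn_toL2 {h : Rd d → ℂ} (hh : MemLp h 2 volume) : toL2 h =ᵐ[volume] h := by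
  rw [toL2, dif_pos hh]
  exact hh.coeFn_toLp

theorem norm_toL2_sub_le {h₁ h₂ : Rd d → ℂ} (m₁ : MemLp h₁ 2 volume) (m₂ : MemLp h₂ 2 volume)
    {c : ℝ} (hc : 0 ≤ c) (h : eLpNorm (fun x => h₁ x - h₂ x) 2 volume ≤ ENNReal.ofReal c) :
    ‖toL2 h₁ - toL2 h₂‖ ≤ c := by
  rw [toL2, toL2, dif_pos m₁, dif_pos m₂, ← MemLp.toLp_sub, Lp.norm_toLp]
  exact ENNReal.toReal_le_of_le_ofReal hc h

theorem solves_iff {A : Op d} {W : Rd d → ℂ → ℂ} {ω : ℂ} {φ : A.domain}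
    (hW : MemLp (fun x => W x ω) ∞ volume)
    (hf : MemLp (fun x => f x ω ((φ : L2 d) x)) 2 volume) :
    Solves A W f ω φ ↔ opL A W ω φ = superposition f ω φ := by
  change Solves A W f ω φ ↔ A φ - mulOp (fun x => W x ω) φ = superposition f ω φ
  rw [Solves, Lp.ext_iff]
  refine eventually_congr ?_
  filter_upwards [coeFn_mulOp hW φ, coeFn_toL2 hf,
    Lp.coeFn_sub (A φ) (mulOp (fun x => W x ω) φ)] with x hmul hsup hsub
  rw [hsub, Pi.sub_apply, hmul, superposition, hsup]

theorem PT_superposition {ω : ℂ} {u : L2 d} (hf : MemLp (fun x => f x ω (u x)) 2 volume)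
    (hPT : ∀ᵐ x, f x ω (PT u x) = conj (f (-x) ω (u (-x)))) (hu : PT u = u) :
    PT (superposition f ω u) = superposition f ω u := by
  apply Lp.ext
  filter_upwards [coeFn_PT (superposition f ω u), coeFn_toL2 hf, ae_comp_neg (coeFn_toL2 hf),
    hPT] with x hx hsup hsup_neg hsymm
  rw [hu] at hsymm
  rw [hx, superposition, hsup, hsup_neg, hsymm]

theorem norm_rescaled_sub_rescaled_le {t c : ℝ} {ω₁ ω₂ : ℂ} {u₁ u₂ : L2 d} (ht : 0 < t)
    (hc : 0 ≤ c) (h₁ : MemLp (fun x => f x ω₁ (((t : ℂ) • u₁ : L2 d) x)) 2 volume)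
    (h₂ : MemLp (fun x => f x ω₂ (((t : ℂ) • u₂ : L2 d) x)) 2 volume)
    (h : eLpNorm (fun x => f x ω₁ ((t : ℂ) * u₁ x) - f x ω₂ ((t : ℂ) * u₂ x)) 2 volume
      ≤ ENNReal.ofReal (t * c)) :
    ‖rescaled f t ω₁ u₁ - rescaled f t ω₂ u₂‖ ≤ c := by
  rw [rescaled, rescaled, ← smul_sub, norm_smul, norm_inv, Complex.norm_real,
    Real.norm_of_nonneg ht.le, inv_mul_le_iff₀ ht]
  refine norm_toL2_sub_le h₁ h₂ (by positivity) (h.trans_eq' (eLpNorm_congr_ae ?_))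
  filter_upwards [Lp.coeFn_smul (t : ℂ) u₁, Lp.coeFn_smul (t : ℂ) u₂] with x hx₁ hx₂
  rw [hx₁, hx₂, Pi.smul_apply, Pi.smul_apply, smul_eq_mul, smul_eq_mul]

theorem memLp_leadingTerm {g : Rd d → ℂ} {α : ℝ} (hα : 0 < α) (hg : MemLp g ∞ volume)
    {u : L2 d} (hu : MemLp u ∞ volume) :
    MemLp (fun x => g x * ((‖u x‖ ^ (1 / α) : ℝ) : ℂ) * u x) 2 volume := by
  have hpow : MemLp (fun x => ((‖u x‖ ^ (1 / α) : ℝ) : ℂ)) ∞ volume := by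
    have h := hu.norm_rpow_div (ENNReal.ofReal (1 / α))
    rw [ENNReal.top_div_of_ne_top ENNReal.ofReal_ne_top,
      ENNReal.toReal_ofReal (by positivity)] at h
    exact h.ofReal
  exact (Lp.memLp u).mul (hpow.mul hg (r := ∞)) (r := 2)

theorem norm_inv_mul_apply_mul_sub_le {h : ℂ → ℂ} {a w : ℂ} {p q C s t B : ℝ}
    (hq : 0 ≤ q) (hh : ∀ z, ‖z‖ < s → ‖h z - a * ((‖z‖ ^ p : ℝ) : ℂ) * z‖ ≤ C * ‖z‖ ^ (q + 1))
    (ht : 0 < t) (hw : ‖w‖ ≤ B) (htB : t * B < s) :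
    ‖(t : ℂ)⁻¹ * h (t * w) - ((t ^ p : ℝ) : ℂ) * (a * ((‖w‖ ^ p : ℝ) : ℂ) * w)‖
      ≤ |C| * B ^ q * t ^ q * ‖w‖ := by
  have htw : ‖(t : ℂ) * w‖ = t * ‖w‖ := by
    rw [norm_mul, Complex.norm_real, Real.norm_of_nonneg ht.le]
  have ht0 : (t : ℂ) ≠ 0 := by exact_mod_cast ht.ne'
  have hhom : (t : ℂ)⁻¹ * h (t * w) - ((t ^ p : ℝ) : ℂ) * (a * ((‖w‖ ^ p : ℝ) : ℂ) * w)
      = (t : ℂ)⁻¹ * (h (t * w) - a * ((‖(t : ℂ) * w‖ ^ p : ℝ) : ℂ) * (t * w)) := by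
    rw [htw, Real.mul_rpow ht.le (norm_nonneg w), Complex.ofReal_mul]
    field_simp
  rw [hhom, norm_mul, norm_inv, Complex.norm_real, Real.norm_of_nonneg ht.le,
    inv_mul_le_iff₀ ht]
  calc ‖h (t * w) - a * ((‖(t : ℂ) * w‖ ^ p : ℝ) : ℂ) * (t * w)‖
      ≤ C * ‖(t : ℂ) * w‖ ^ (q + 1) := hh _ (by rw [htw]; exact htB.trans_le' (by gcongr))
    _ ≤ |C| * (t * ‖w‖) ^ (q + 1) := by rw [htw]; gcongr; exact le_abs_self C
    _ = t * (|C| * ‖w‖ ^ q * t ^ q * ‖w‖) := by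
      rw [Real.rpow_add_one' (by positivity) (by positivity), Real.mul_rpow ht.le (norm_nonneg w)]
      ring
    _ ≤ t * (|C| * B ^ q * t ^ q * ‖w‖) := by gcongr

end Superposition

section Nonlinearity

open GraphDomain (mk incl)

/-- The properties of the nonlinearity from which the branch is constructed: it acts on small
elements of the domain of `A`, its Lipschitz constant on the ball around `l φ₀` is of order
`l ^ (1 / α)`, and at `ω₀` it is `g |z| ^ (1 / α) z` up to terms of higher order. -/
structure AsymptoticNonlinearity (A : Op d) (ω₀ : ℂ) (φ₀ : A.domain) (δ α β : ℝ)
    (f : Rd d → ℂ → ℂ → ℂ) (g : Rd d → ℂ) : Prop where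
  memL2 : ∀ ω ∈ Metric.ball ω₀ δ, ∀ u : A.domain, graphNorm A u < δ →
    MemLp (fun x => f x ω ((u : L2 d) x)) 2 volume
  lipschitz : ∃ l₀ : ℝ, 0 < l₀ ∧ ∃ K : ℝ, ∀ l ∈ Ioo (0 : ℝ) l₀,
    (∀ ω₁ ∈ Metric.ball ω₀ δ, ∀ ω₂ ∈ Metric.ball ω₀ δ, ∀ u : A.domain, graphNorm A (u - φ₀) < δ →
      eLpNorm (fun x => f x ω₁ ((l : ℂ) * (u : L2 d) x) - f x ω₂ ((l : ℂ) * (u : L2 d) x)) 2 volume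
        ≤ ENNReal.ofReal (K * l ^ (1 / α + 1) * ‖ω₁ - ω₂‖)) ∧
    (∀ ω ∈ Metric.ball ω₀ δ, ∀ u₁ u₂ : A.domain,
      graphNorm A (u₁ - φ₀) < δ → graphNorm A (u₂ - φ₀) < δ →
      eLpNorm (fun x => f x ω ((l : ℂ) * (u₁ : L2 d) x) - f x ω ((l : ℂ) * (u₂ : L2 d) x)) 2 volume
        ≤ ENNReal.ofReal (K * l ^ (1 / α + 1) * ‖(u₁ : L2 d) - (u₂ : L2 d)‖))
  memLp_top : MemLp g ∞ volume
  asymptotics : ∃ C s : ℝ, 0 < s ∧ ∀ᵐ x : Rd d, ∀ z : ℂ, ‖z‖ < s →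
    ‖f x ω₀ z - g x * ((‖z‖ ^ (1 / α) : ℝ) : ℂ) * z‖ ≤ C * ‖z‖ ^ (1 / α + 1 + β)

variable {A : Op d} {ω₀ : ℂ} {φ₀ : A.domain} {δ α β : ℝ} {f : Rd d → ℂ → ℂ → ℂ}

theorem AssumptionF.asymptoticNonlinearity {g : ℂ → Rd d → ℂ}
    (h : AssumptionF A ω₀ φ₀ δ α β f g) (hδ : 0 < δ) :
    AsymptoticNonlinearity A ω₀ φ₀ δ α β f (g ω₀) where
  memL2 := h.memL2
  lipschitz := h.lipschitz
  memLp_top := (h.g_mem ω₀ (Metric.mem_ball_self hδ)).1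
  asymptotics := by
    obtain ⟨C, s, hs, hC⟩ := h.asymptotics
    exact ⟨C, s, hs, hC ω₀ (Metric.mem_ball_self hδ)⟩

theorem AssumptionA.memLp_top (hA : AssumptionA A) (u : A.domain) : MemLp (u : L2 d) ∞ volume := by
  obtain ⟨C, hC⟩ := hA.embedding
  exact ⟨Lp.aestronglyMeasurable _, (hC u).trans_lt ENNReal.ofReal_lt_top⟩

theorem eventually_norm_smul_lt {E : Type*} [NormedAddCommGroup E] [NormedSpace ℂ E] (e : E)
    (hδ : 0 < δ) : ∀ᶠ t : ℝ in 𝓝[>] 0, ∀ u : E, ‖u - e‖ < δ → ‖(t : ℂ) • u‖ < δ := by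
  have hlim : Tendsto (fun t : ℝ => t * (δ + ‖e‖)) (𝓝[>] 0) (𝓝 0) :=
    tendsto_nhdsWithin_of_tendsto_nhds ((continuous_mul_const _).tendsto' 0 0 (zero_mul _))
  filter_upwards [hlim.eventually_lt_const hδ, self_mem_nhdsWithin] with t ht htpos u hu
  have htpos : 0 < t := htpos
  rw [norm_smul, Complex.norm_real, Real.norm_of_nonneg htpos.le]
  refine ht.trans_le' ?_
  gcongr
  linarith [norm_sub_norm_le u e]

namespace AsymptoticNonlinearity

variable {g : Rd d → ℂ} (hf : AsymptoticNonlinearity A ω₀ φ₀ δ α β f g)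

include hf

theorem eventually_memLp (hδ : 0 < δ) : ∀ᶠ t : ℝ in 𝓝[>] 0, ∀ ω ∈ Metric.ball ω₀ δ,
    ∀ u : GraphDomain A, ‖u - GraphDomain.mk φ₀‖ < δ →
      MemLp (fun x => f x ω (((t : ℂ) • incl A u : L2 d) x)) 2 volume := by
  filter_upwards [eventually_norm_smul_lt (GraphDomain.mk φ₀) hδ] with t ht ω hω u hu
  exact hf.memL2 ω hω (GraphDomain.mk.symm ((t : ℂ) • u)) (ht u hu)

theorem exists_norm_rescaled_sub_rescaled_le (hδ : 0 < δ) :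
    ∃ K : ℝ, 0 ≤ K ∧ ∀ᶠ t : ℝ in 𝓝[>] 0, ∀ ω₁ ∈ Metric.ball ω₀ δ, ∀ ω₂ ∈ Metric.ball ω₀ δ,
      ∀ u₁ u₂ : GraphDomain A, ‖u₁ - GraphDomain.mk φ₀‖ < δ → ‖u₂ - GraphDomain.mk φ₀‖ < δ →
        ‖rescaled f t ω₁ (incl A u₁) - rescaled f t ω₂ (incl A u₂)‖
          ≤ K * t ^ (1 / α) * (‖ω₁ - ω₂‖ + ‖u₁ - u₂‖) := by
  obtain ⟨l₀, hl₀, K, hK⟩ := hf.lipschitz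
  refine ⟨|K|, abs_nonneg K, ?_⟩
  filter_upwards [hf.eventually_memLp hδ, Ioo_mem_nhdsGT hl₀]
    with t hmem ht ω₁ hω₁ ω₂ hω₂ u₁ u₂ hu₁ hu₂
  obtain ⟨hKω, hKu⟩ := hK t ht
  have ht0 : 0 < t := ht.1
  have hbound : ∀ s : ℝ, 0 ≤ s → ENNReal.ofReal (K * t ^ (1 / α + 1) * s)
      ≤ ENNReal.ofReal (t * (|K| * t ^ (1 / α) * s)) := fun s hs => by
    refine ENNReal.ofReal_le_ofReal ?_
    rw [Real.rpow_add ht0, Real.rpow_one]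
    calc K * (t ^ (1 / α) * t) * s ≤ |K| * (t ^ (1 / α) * t) * s := by
          gcongr
          exact le_abs_self K
      _ = t * (|K| * t ^ (1 / α) * s) := by ring
  have hω : ‖rescaled f t ω₁ (incl A u₁) - rescaled f t ω₂ (incl A u₁)‖
      ≤ |K| * t ^ (1 / α) * ‖ω₁ - ω₂‖ :=
    norm_rescaled_sub_rescaled_le ht0 (by positivity) (hmem ω₁ hω₁ u₁ hu₁) (hmem ω₂ hω₂ u₁ hu₁)
      ((hKω ω₁ hω₁ ω₂ hω₂ _ hu₁).trans (hbound _ (norm_nonneg _)))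
  have hu : ‖rescaled f t ω₂ (incl A u₁) - rescaled f t ω₂ (incl A u₂)‖
      ≤ |K| * t ^ (1 / α) * ‖incl A (u₁ - u₂)‖ :=
    norm_rescaled_sub_rescaled_le ht0 (by positivity) (hmem ω₂ hω₂ u₁ hu₁) (hmem ω₂ hω₂ u₂ hu₂)
      ((hKu ω₂ hω₂ _ _ hu₁ hu₂).trans (hbound _ (norm_nonneg _)))
  rw [mul_add]
  refine (norm_sub_le_norm_sub_add_norm_sub _ _ _).trans (add_le_add hω (hu.trans ?_))
  gcongr
  exact GraphDomain.norm_incl_le _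

theorem exists_norm_rescaled_sub_leadingTerm_le (hδ : 0 < δ) (hα : 0 < α) (hβ : 0 ≤ β)
    (hφ₀ : MemLp (φ₀ : L2 d) ∞ volume) :
    ∃ C : ℝ, ∀ᶠ t : ℝ in 𝓝[>] 0,
      ‖rescaled f t ω₀ φ₀ - ((t ^ (1 / α) : ℝ) : ℂ) • leadingTerm g α φ₀‖
        ≤ C * t ^ (1 / α + β) := by
  obtain ⟨C, s, hs, hC⟩ := hf.asymptotics
  obtain ⟨B, hB⟩ : ∃ B : ℝ, ∀ᵐ x, ‖(φ₀ : L2 d) x‖ ≤ B :=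
    ⟨_, ae_norm_le_of_eLpNorm_top_le ENNReal.toReal_nonneg (ENNReal.ofReal_toReal hφ₀.2.ne).ge⟩
  have hlim : Tendsto (fun t : ℝ => t * B) (𝓝[>] 0) (𝓝 0) :=
    tendsto_nhdsWithin_of_tendsto_nhds ((continuous_mul_const B).tendsto' 0 0 (zero_mul B))
  refine ⟨|C| * B ^ (1 / α + β) * ‖(φ₀ : L2 d)‖, ?_⟩
  filter_upwards [hlim.eventually_lt_const hs, hf.eventually_memLp hδ, self_mem_nhdsWithin]
    with t htB hmem ht
  have hmem₀ : MemLp (fun x => f x ω₀ (((t : ℂ) • (φ₀ : L2 d) : L2 d) x)) 2 volume :=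
    hmem ω₀ (Metric.mem_ball_self hδ) (GraphDomain.mk φ₀) (by simpa)
  rw [mul_right_comm]
  apply Lp.norm_le_mul_norm_of_ae_le_mul
  filter_upwards [Lp.coeFn_sub (rescaled f t ω₀ (φ₀ : L2 d))
      (((t ^ (1 / α) : ℝ) : ℂ) • leadingTerm g α (φ₀ : L2 d)),
    Lp.coeFn_smul ((t : ℂ)⁻¹) (superposition f ω₀ ((t : ℂ) • (φ₀ : L2 d))),
    Lp.coeFn_smul ((t ^ (1 / α) : ℝ) : ℂ) (leadingTerm g α φ₀), coeFn_toL2 hmem₀,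
    coeFn_toL2 (memLp_leadingTerm hα hf.memLp_top hφ₀), Lp.coeFn_smul (t : ℂ) (φ₀ : L2 d), hB, hC]
    with x hsub hres hlead hsup htop hsmul hBx hCx
  rw [hsub, Pi.sub_apply, rescaled, hres, Pi.smul_apply, superposition, hsup, hsmul,
    Pi.smul_apply, hlead, Pi.smul_apply, leadingTerm, htop]
  refine norm_inv_mul_apply_mul_sub_le (by positivity) (fun z hz => ?_) ht hBx htB
  rw [add_right_comm]
  exact hCx z hz

end AsymptoticNonlinearity

/-- `A`, `W(·, ω)` and `φ ↦ f(·, ω, φ)` are `PT`-symmetric, for real `ω` near `ω₀`. -/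
structure PTEquivariant (A : Op d) (W : Rd d → ℂ → ℂ) (f : Rd d → ℂ → ℂ → ℂ) (ω₀ δ : ℝ) :
    Prop where
  opA : PTOperator A
  potential : ∀ ω : ℝ, |ω - ω₀| < δ → PTFunction fun x => W x ω
  nonlinearity : ∀ ω : ℝ, |ω - ω₀| < δ → ∀ u : A.domain, graphNorm A u < δ →
    ∀ᵐ x, f x ω (PT (u : L2 d) x) = conj (f (-x) ω ((u : L2 d) (-x)))

theorem PTSymmetricProblem.ptEquivariant {W : Rd d → ℂ → ℂ} {g : ℂ → Rd d → ℂ} {ω₀ : ℝ}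
    (h : PTSymmetricProblem A W f g ω₀ δ) : PTEquivariant A W f ω₀ δ where
  opA := h.opA
  potential := h.potential
  nonlinearity := h.nonlinearity

end Nonlinearity

section ReducedProblem

open GraphDomain (mk incl)

/-- The right-hand side of the problem in the unknowns `p = (u, μ)` with `ω = ω₀ + μ` and
`φ = t (φ₀ + u)`, once it is divided by `t` and its part `L(·, ω₀) u - μ ∂_ω W(·, ω₀) φ₀`
linear in `(u, μ)` is moved to the left. -/
def reducedMap (A : Op d) (W : Rd d → ℂ → ℂ) (f : Rd d → ℂ → ℂ → ℂ) (ω₀ : ℂ) (φ₀ : A.domain)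
    (t : ℝ) (p : GraphDomain A × ℂ) : L2 d :=
  secondOrderRemainder (fun ω => mulOp fun x => W x ω) (mulOp fun x => deriv (W x) ω₀) ω₀
      (φ₀ : L2 d) (incl A p.1, p.2)
    + rescaled f t (ω₀ + p.2) (incl A (mk φ₀ + p.1))

section Equation

variable {A : Op d} {W : Rd d → ℂ → ℂ} {f : Rd d → ℂ → ℂ → ℂ} {ω₀ : ℂ} {φ₀ : A.domain}
  {φs : L2 d} {α η ε : ℝ}

theorem linearization_add_eq_sub_secondOrderRemainder (hφ₀ : linearization A W ω₀ (mk φ₀) = 0)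
    (p : GraphDomain A × ℂ) :
    linearization A W (ω₀ + p.2) (mk φ₀ + p.1)
      = linearization A W ω₀ p.1 - p.2 • mulOp (fun x => deriv (W x) ω₀) φ₀
        - secondOrderRemainder (fun ω => mulOp fun x => W x ω) (mulOp fun x => deriv (W x) ω₀) ω₀
          (φ₀ : L2 d) (incl A p.1, p.2) := by
  have hshift : linearization A W (ω₀ + p.2) (mk φ₀ + p.1)
      = linearization A W ω₀ (mk φ₀ + p.1)
        - (mulOp (fun x => W x (ω₀ + p.2)) - mulOp fun x => W x ω₀) (φ₀ + incl A p.1) := by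
    rw [← show incl A (mk φ₀ + p.1) = φ₀ + incl A p.1 from rfl]
    simp only [linearization, sub_apply, ContinuousLinearMap.comp_apply]
    abel
  rw [hshift, map_add, hφ₀, secondOrderRemainder]
  abel

theorem solves_smul_add_iff {t : ℝ} (ht : t ≠ 0) (hφ₀ : linearization A W ω₀ (mk φ₀) = 0)
    {p : GraphDomain A × ℂ} (hW : MemLp (fun x => W x (ω₀ + p.2)) ∞ volume)
    (hf : MemLp (fun x => f x (ω₀ + p.2) (((t : ℂ) • incl A (mk φ₀ + p.1) : L2 d) x)) 2 volume) :
    Solves A W f (ω₀ + p.2) (mk.symm ((t : ℂ) • (mk φ₀ + p.1))) ↔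
      linearization A W ω₀ p.1 - p.2 • mulOp (fun x => deriv (W x) ω₀) φ₀
        = reducedMap A W f ω₀ φ₀ t p := by
  have ht : (t : ℂ) ≠ 0 := Complex.ofReal_ne_zero.2 ht
  have hL : opL A W (ω₀ + p.2) (mk.symm ((t : ℂ) • (mk φ₀ + p.1)))
      = (t : ℂ) • linearization A W (ω₀ + p.2) (mk φ₀ + p.1) :=
    map_smul (linearization A W (ω₀ + p.2)) (t : ℂ) _
  refine (solves_iff hW hf).trans ((Eq.congr_left hL).trans ?_)
  rw [← eq_inv_smul_iff₀ ht, linearization_add_eq_sub_secondOrderRemainder hφ₀, sub_eq_iff_eq_add']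
  rfl

theorem near_smul_add_iff (hε : 0 < ε) {p : GraphDomain A × ℂ} :
    ‖ω₀ + p.2 - ω₀‖ < η ∧ graphNorm A (mk.symm (((ε ^ α : ℝ) : ℂ) • (mk φ₀ + p.1))
      - ((ε ^ α : ℝ) : ℂ) • φ₀) < η * ε ^ α ↔ ‖p‖ < η := by
  have ht : 0 < ε ^ α := Real.rpow_pos_of_pos hε α
  have hnear : ‖((ε ^ α : ℝ) : ℂ) • (mk φ₀ + p.1) - ((ε ^ α : ℝ) : ℂ) • mk φ₀‖ < η * ε ^ α
      ↔ ‖p.1‖ < η := by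
    rw [← smul_sub, add_sub_cancel_left, norm_smul, Complex.norm_real, Real.norm_of_nonneg ht.le,
      mul_comm, mul_lt_mul_iff_left₀ ht]
  rw [Prod.norm_def, sup_lt_iff, ← hnear, add_sub_cancel_left]
  exact and_comm

theorem pairing_smul_add_eq_iff (h : SimpleEigenvalue A W ω₀ φ₀ φs) {t : ℂ} (ht : t ≠ 0)
    (u : GraphDomain A) : pairing A φs (t • (mk φ₀ + u)) = t ↔ pairing A φs u = 0 := by
  rw [map_smul, map_add, h.pairing_mk, smul_eq_mul, mul_eq_left₀ ht, add_eq_left]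

theorem exists_eq_smul_add {t : ℂ} (ht : t ≠ 0) (ω : ℂ) (φ : A.domain) :
    ∃ q : GraphDomain A × ℂ, ω₀ + q.2 = ω ∧ mk.symm (t • (mk φ₀ + q.1)) = φ :=
  ⟨(t⁻¹ • mk φ - mk φ₀, ω - ω₀), add_sub_cancel _ _, by
    rw [add_sub_cancel, smul_inv_smul₀ ht, LinearEquiv.symm_apply_apply]⟩

end Equation

section Estimates

variable {A : Op d} {W : Rd d → ℂ → ℂ} {f : Rd d → ℂ → ℂ → ℂ} {ω₀ : ℂ} {φ₀ : A.domain}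
  {φs : L2 d} {g : Rd d → ℂ} {δ α β τ η : ℝ}

theorem tendsto_rpow_nhdsGT_zero (hα : 0 < α) :
    Tendsto (fun ε : ℝ => ε ^ α) (𝓝[>] 0) (𝓝[>] 0) := by
  refine tendsto_nhdsWithin_iff.2 ⟨tendsto_nhdsWithin_of_tendsto_nhds ?_, ?_⟩
  · exact (Real.continuous_rpow_const hα.le).tendsto' 0 0 (Real.zero_rpow hα.ne')
  · filter_upwards [self_mem_nhdsWithin] with ε hε using Real.rpow_pos_of_pos hε α

theorem eventually_localSolution_iff (h : SimpleEigenvalue A W ω₀ φ₀ φs) (hδ : 0 < δ) (hα : 0 < α)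
    (hW : AssumptionW W ω₀ δ) (hf : AsymptoticNonlinearity A ω₀ φ₀ δ α β f g) (hη : η ≤ δ) :
    ∀ᶠ ε in 𝓝[>] 0, ∀ p : GraphDomain A × ℂ,
      LocalSolution A W f ω₀ φ₀ φs α η ε (ω₀ + p.2)
          (mk.symm (((ε ^ α : ℝ) : ℂ) • (mk φ₀ + p.1))) ↔
        ‖p‖ < η ∧ borderedLinearization A W ω₀ φ₀ φs p
          = (reducedMap A W f ω₀ φ₀ (ε ^ α) p, 0) := by
  filter_upwards [(tendsto_rpow_nhdsGT_zero hα).eventually (hf.eventually_memLp hδ),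
    self_mem_nhdsWithin] with ε hmem hε p
  have ht : ε ^ α ≠ 0 := (Real.rpow_pos_of_pos hε α).ne'
  have hsolves (hp : ‖p‖ < η) := by
    have hω : ω₀ + p.2 ∈ Metric.ball ω₀ δ :=
      add_mem_ball_iff_norm.2 ((norm_snd_le p).trans_lt (hp.trans_le hη))
    have hu : ‖mk φ₀ + p.1 - mk φ₀‖ < δ :=
      mem_ball_iff_norm.1 (add_mem_ball_iff_norm.2 ((norm_fst_le p).trans_lt (hp.trans_le hη)))
    exact solves_smul_add_iff ht (apply_eq_zero_of_ker_eq_span h.ker_linearization)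
      (hW.memLp hω) (hmem _ hω _ hu)
  have hconstraint := pairing_smul_add_eq_iff h (Complex.ofReal_ne_zero.2 ht) p.1
  rw [borderedLinearization, bordered_apply, Prod.mk.injEq]
  constructor
  · intro hsol
    have hp : ‖p‖ < η := (near_smul_add_iff hε).1 ⟨hsol.near_omega, hsol.near_phi⟩
    exact ⟨hp, (hsolves hp).1 hsol.solves, hconstraint.1 hsol.constraint⟩
  · rintro ⟨hp, heq, hpair⟩
    obtain ⟨hω, hφ⟩ := (near_smul_add_iff hε).2 hp
    exact ⟨(hsolves hp).2 heq, hconstraint.2 hpair, hω, hφ⟩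

theorem exists_norm_reducedMap_sub_le (hδ : 0 < δ) (hα : 0 < α) (hW : AssumptionW W ω₀ δ)
    (hf : AsymptoticNonlinearity A ω₀ φ₀ δ α β f g) :
    ∃ κ : ℝ, 0 ≤ κ ∧ ∀ᶠ ε : ℝ in 𝓝[>] 0, ∀ ρ ≤ δ / 4, ∀ p q : GraphDomain A × ℂ,
      ‖p‖ ≤ ρ → ‖q‖ ≤ ρ → ‖reducedMap A W f ω₀ φ₀ (ε ^ α) p - reducedMap A W f ω₀ φ₀ (ε ^ α) q‖
        ≤ κ * (ρ + ε) * ‖p - q‖ := by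
  obtain ⟨C, hC, hM⟩ := hW.hasLipschitzDerivAt_mulOp hδ
  obtain ⟨K, hK, hres⟩ := hf.exists_norm_rescaled_sub_rescaled_le hδ
  set C' := C * (‖(φ₀ : L2 d)‖ + 2 * (δ / 4)) + 2 * ‖mulOp fun x => deriv (W x) ω₀‖
  refine ⟨C' + 2 * K, by positivity, ?_⟩
  filter_upwards [(tendsto_rpow_nhdsGT_zero hα).eventually hres, self_mem_nhdsWithin]
    with ε hres hε ρ hρ p q hp hq
  have hε : 0 < ε := hε
  have hρ0 : 0 ≤ ρ := (norm_nonneg p).trans hp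
  rw [one_div, Real.rpow_rpow_inv hε.le hα.ne'] at hres
  have hincl : ∀ r : GraphDomain A × ℂ, ‖(incl A r.1, r.2)‖ ≤ ‖r‖ := fun r =>
    max_le_max_right _ (GraphDomain.norm_incl_le r.1)
  have hball : ∀ {r : GraphDomain A × ℂ}, ‖r‖ ≤ ρ →
      ω₀ + r.2 ∈ Metric.ball ω₀ δ ∧ ‖mk φ₀ + r.1 - mk φ₀‖ < δ := fun {r} hr => by
    rw [mem_ball_iff_norm, add_sub_cancel_left, add_sub_cancel_left]
    exact ⟨by linarith [norm_snd_le r], by linarith [norm_fst_le r]⟩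
  have hrem := (hM.norm_secondOrderRemainder_sub_le hC hρ (φ₀ : L2 d) ((hincl p).trans hp)
    ((hincl q).trans hq)).trans (mul_le_mul_of_nonneg_left (hincl (p - q)) (by positivity))
  have hnl := hres _ (hball hp).1 _ (hball hq).1 _ _ (hball hp).2 (hball hq).2
  rw [add_sub_add_left_eq_sub, add_sub_add_left_eq_sub] at hnl
  calc ‖reducedMap A W f ω₀ φ₀ (ε ^ α) p - reducedMap A W f ω₀ φ₀ (ε ^ α) q‖
      ≤ C' * ρ * ‖p - q‖ + K * ε * (‖p.2 - q.2‖ + ‖p.1 - q.1‖) := by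
        rw [reducedMap, reducedMap, add_sub_add_comm]
        exact (norm_add_le _ _).trans (add_le_add hrem hnl)
    _ ≤ C' * (ρ + ε) * ‖p - q‖ + K * (ρ + ε) * (‖p - q‖ + ‖p - q‖) := by
        gcongr
        · linarith
        · linarith
        · exact norm_snd_le (p - q)
        · exact norm_fst_le (p - q)
    _ = (C' + 2 * K) * (ρ + ε) * ‖p - q‖ := by ring

theorem reducedMap_zero (t : ℝ) : reducedMap A W f ω₀ φ₀ t 0 = rescaled f t ω₀ φ₀ := by
  have hrem := secondOrderRemainder_zero (fun ω => mulOp fun x => W x ω)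
    (mulOp fun x => deriv (W x) ω₀) ω₀ (φ₀ : L2 d)
  rw [reducedMap, Prod.fst_zero, Prod.snd_zero, map_zero, Prod.mk_zero_zero, hrem, zero_add,
    add_zero, add_zero]
  rfl

theorem exists_norm_reducedMap_zero_sub_le (hδ : 0 < δ) (hα : 0 < α) (hβ : 0 ≤ β)
    (hτ : τ ≤ α * β) (hf : AsymptoticNonlinearity A ω₀ φ₀ δ α β f g)
    (hφ₀ : MemLp (φ₀ : L2 d) ∞ volume) :
    ∃ C : ℝ, 0 ≤ C ∧ ∀ᶠ ε : ℝ in 𝓝[>] 0,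
      ‖reducedMap A W f ω₀ φ₀ (ε ^ α) 0 - (ε : ℂ) • leadingTerm g α φ₀‖ ≤ C * ε ^ (1 + τ) := by
  obtain ⟨C, hC⟩ := hf.exists_norm_rescaled_sub_leadingTerm_le hδ hα hβ hφ₀
  refine ⟨|C|, abs_nonneg C, ?_⟩
  filter_upwards [(tendsto_rpow_nhdsGT_zero hα).eventually hC, Ioo_mem_nhdsGT one_pos]
    with ε hC hε
  have hexp : α * (1 / α + β) = 1 + α * β := by field_simp
  rw [← Real.rpow_mul hε.1.le, ← Real.rpow_mul hε.1.le, mul_one_div_cancel hα.ne', Real.rpow_one,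
    hexp] at hC
  rw [reducedMap_zero]
  refine hC.trans (mul_le_mul (le_abs_self C) ?_ (Real.rpow_nonneg hε.1.le _) (abs_nonneg C))
  exact Real.rpow_le_rpow_of_exponent_ge hε.1 hε.2.le (by linarith)

end Estimates

end ReducedProblem

section Branch

open GraphDomain (mk incl)

variable {A : Op d} {W : Rd d → ℂ → ℂ} {f : Rd d → ℂ → ℂ → ℂ} {g : Rd d → ℂ} {φ₀ : A.domain}
  {φs : L2 d} {ω₀ δ α β τ : ℝ}

theorem exists_ofReal_of_mem_symmetricPairs {p : GraphDomain A × ℂ} (hp : p ∈ symmetricPairs A)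
    (hpδ : ‖p‖ < δ) : ∃ ω : ℝ, ω₀ + p.2 = ω ∧ |ω - ω₀| < δ := by
  obtain ⟨μ, hμ⟩ := Complex.conj_eq_iff_real.1 hp.2
  have hμδ : |μ| < δ := by simpa [hμ] using (norm_snd_le p).trans_lt hpδ
  exact ⟨ω₀ + μ, by rw [hμ, Complex.ofReal_add], by rwa [add_sub_cancel_left]⟩

theorem PT_secondOrderRemainder (hδ : 0 < δ) (hW : AssumptionW W ω₀ δ)
    (hPTW : ∀ ω : ℝ, |ω - ω₀| < δ → PTFunction fun x => W x ω) (hφ₀ : PT (φ₀ : L2 d) = φ₀)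
    {p : GraphDomain A × ℂ} (hp : p ∈ symmetricPairs A) (hpδ : ‖p‖ < δ) :
    PT (secondOrderRemainder (fun ω => mulOp fun x => W x ω) (mulOp fun x => deriv (W x) ω₀) ω₀
        (φ₀ : L2 d) (incl A p.1, p.2))
      = secondOrderRemainder (fun ω => mulOp fun x => W x ω) (mulOp fun x => deriv (W x) ω₀) ω₀
        (φ₀ : L2 d) (incl A p.1, p.2) := by
  have hmulOp : ∀ ω : ℝ, |ω - ω₀| < δ → ∀ u : L2 d,
      PT (mulOp (fun x => W x ω) u) = mulOp (fun x => W x ω) (PT u) := fun ω hω =>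
    PT_mulOp (hW.memLp (by rwa [Metric.mem_ball, Complex.isometry_ofReal.dist_eq])) (hPTW ω hω)
  have hderiv := PT_mulOp (hW.memLp_deriv hδ)
    (ptFunction_deriv hδ (hW.ae_differentiableAt hδ) hPTW) (φ₀ : L2 d)
  obtain ⟨ω, hω, hωδ⟩ := exists_ofReal_of_mem_symmetricPairs (ω₀ := ω₀) hp hpδ
  rw [secondOrderRemainder, hω, sub_apply, PT_sub, PT_sub, PT_smul, hmulOp ω hωδ,
    hmulOp ω₀ (by simpa), PT_add, hφ₀, hp.1, hp.2, hderiv, hφ₀]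

theorem PT_smul_add (hφ₀ : PT (φ₀ : L2 d) = φ₀) {p : GraphDomain A × ℂ}
    (hp : p ∈ symmetricPairs A) (t : ℝ) :
    PT ((t : ℂ) • incl A (mk φ₀ + p.1)) = (t : ℂ) • incl A (mk φ₀ + p.1) := by
  rw [map_add, PT_smul, PT_add, hp.1, Complex.conj_ofReal]
  exact congrArg (fun v => (t : ℂ) • (v + incl A p.1)) hφ₀

theorem eventually_PT_rescaled (hδ : 0 < δ) (hf : AsymptoticNonlinearity A ω₀ φ₀ δ α β f g)
    (hPT : PTEquivariant A W f ω₀ δ) (hφ₀ : PT (φ₀ : L2 d) = φ₀) :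
    ∀ᶠ t : ℝ in 𝓝[>] 0, ∀ p ∈ symmetricPairs A, ‖p‖ < δ →
      PT (rescaled f t (ω₀ + p.2) (incl A (mk φ₀ + p.1)))
        = rescaled f t (ω₀ + p.2) (incl A (mk φ₀ + p.1)) := by
  filter_upwards [hf.eventually_memLp hδ, eventually_norm_smul_lt (mk φ₀) hδ]
    with t hmem hball p hp hpδ
  have hu : ‖mk φ₀ + p.1 - mk φ₀‖ < δ := by
    rw [add_sub_cancel_left]
    exact (norm_fst_le p).trans_lt hpδ
  have hω₀ : ω₀ + p.2 ∈ Metric.ball (ω₀ : ℂ) δ :=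
    add_mem_ball_iff_norm.2 ((norm_snd_le p).trans_lt hpδ)
  obtain ⟨ω, hω, hωδ⟩ := exists_ofReal_of_mem_symmetricPairs (ω₀ := ω₀) hp hpδ
  have hmemω := hmem _ hω₀ _ hu
  rw [hω] at hmemω ⊢
  rw [rescaled, PT_smul, map_inv₀, Complex.conj_ofReal, PT_superposition hmemω
    (hPT.nonlinearity ω hωδ (mk.symm ((t : ℂ) • (mk φ₀ + p.1))) (hball _ hu))
    (PT_smul_add hφ₀ hp t)]

theorem eventually_PT_reducedMap (hδ : 0 < δ) (hW : AssumptionW W ω₀ δ)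
    (hf : AsymptoticNonlinearity A ω₀ φ₀ δ α β f g) (hPT : PTEquivariant A W f ω₀ δ)
    (hφ₀ : PT (φ₀ : L2 d) = φ₀) :
    ∀ᶠ t : ℝ in 𝓝[>] 0, ∀ p ∈ symmetricPairs A, ‖p‖ < δ →
      PT (reducedMap A W f ω₀ φ₀ t p) = reducedMap A W f ω₀ φ₀ t p := by
  filter_upwards [eventually_PT_rescaled hδ hf hPT hφ₀] with t hres p hp hpδ
  rw [reducedMap, PT_add, hres p hp hpδ,
    PT_secondOrderRemainder hδ hW hPT.potential hφ₀ hp hpδ]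

theorem exists_fixedPoint_branch_reducedMap (hA : A.IsClosed) (hδ : 0 < δ) (hα : 0 < α)
    (hτ : 0 ≤ τ) (hτ' : τ ≤ min 1 (α * β)) (hφ₀ : MemLp (φ₀ : L2 d) ∞ volume)
    (hW : AssumptionW W ω₀ δ) (hf : AsymptoticNonlinearity A ω₀ φ₀ δ α β f g)
    (hPT : PTEquivariant A W f ω₀ δ) (hPTφ₀ : PT (φ₀ : L2 d) = φ₀)
    {T : L2 d →L[ℂ] GraphDomain A × ℂ} (hT : ∀ y, PT y = y → T y ∈ symmetricPairs A) :
    ∃ ρ > 0, ρ ≤ δ / 4 ∧ ∃ r > 0, ∀ᶠ ε : ℝ in 𝓝[>] 0, ∃ p ∈ symmetricPairs A,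
      (∀ q, ‖q‖ < ρ ∧ T (reducedMap A W f ω₀ φ₀ (ε ^ α) q) = q ↔ q = p) ∧
      ∃ s, ‖s‖ ≤ r ∧
        p = (ε : ℂ) • T (leadingTerm g α φ₀) + ((ε ^ (1 + τ) : ℝ) : ℂ) • s := by
  have hcomplete := GraphDomain.completeSpace hA
  obtain ⟨hτ1, hταβ⟩ := le_min_iff.1 hτ'
  have hβ : 0 ≤ β := nonneg_of_mul_nonneg_right (hτ.trans hταβ) hα
  obtain ⟨κ, hκ, hlip⟩ := exists_norm_reducedMap_sub_le hδ hα hW hf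
  obtain ⟨C, hC, hzero⟩ := exists_norm_reducedMap_zero_sub_le (W := W) hδ hα hβ hταβ hf hφ₀
  refine exists_fixedPoint_branch_expansion (κ := ‖T‖ * κ) (C := ‖T‖ * C)
    (Φ := fun ε p => T (reducedMap A W f ω₀ φ₀ (ε ^ α) p)) isClosed_symmetricPairs
    zero_mem_symmetricPairs (by positivity) (by positivity) (by positivity) hτ hτ1 ?_ ?_ ?_
  · filter_upwards [(tendsto_rpow_nhdsGT_zero hα).eventually
      (eventually_PT_reducedMap hδ hW hf hPT hPTφ₀)] with ε hsymm p hp hpδ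
    exact hT _ (hsymm p hp (hpδ.trans_lt (by linarith)))
  · filter_upwards [hlip] with ε hlip ρ hρ p q hp hq
    rw [← map_sub, mul_assoc, mul_assoc, ← mul_assoc κ]
    exact T.le_opNorm_of_le (hlip ρ hρ p q hp hq)
  · filter_upwards [hzero] with ε hzero
    rw [← map_smul, ← map_sub, mul_assoc]
    exact T.le_opNorm_of_le hzero

theorem exists_branch (h : SimpleEigenvalue A W ω₀ φ₀ φs) (hδ : 0 < δ) (hα : 0 < α)
    (hτ : 0 ≤ τ) (hτ' : τ ≤ min 1 (α * β)) (hφ₀ : MemLp (φ₀ : L2 d) ∞ volume)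
    (hW : AssumptionW W ω₀ δ) (hWt : Transversal W ω₀ φ₀ φs)
    (hf : AsymptoticNonlinearity A ω₀ φ₀ δ α β f g) (hPT : PTEquivariant A W f ω₀ δ)
    (hPTφ₀ : PT (φ₀ : L2 d) = φ₀) :
    ∃ η > 0, ∃ r > 0, ∃ e : GraphDomain A × ℂ, pairing A φs e.1 = 0 ∧
      ∀ᶠ ε : ℝ in 𝓝[>] 0, ∃ p ∈ symmetricPairs A,
        (∀ q : GraphDomain A × ℂ, LocalSolution A W f ω₀ φ₀ φs α η ε (ω₀ + q.2)
          (mk.symm (((ε ^ α : ℝ) : ℂ) • (mk φ₀ + q.1))) ↔ q = p) ∧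
        ∃ s, ‖s‖ ≤ r ∧ pairing A φs s.1 = 0 ∧
          p = (ε : ℂ) • e + ((ε ^ (1 + τ) : ℝ) : ℂ) • s := by
  obtain ⟨T, hT⟩ := h.exists_solutionOperator hδ hW hWt
  have hpairing : ∀ y, pairing A φs (T y).1 = 0 := fun y => congrArg Prod.snd ((hT y _).2 rfl)
  obtain ⟨η, hη, hηδ, r, hr, hbranch⟩ := exists_fixedPoint_branch_reducedMap h.closed hδ hα hτ hτ'
    hφ₀ hW hf hPT hPTφ₀
    fun _ => h.solutionOperator_mem_symmetricPairs hδ hW hPT.opA hPT.potential hPTφ₀ hT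
  refine ⟨η, hη, r, hr, T (leadingTerm g α φ₀), hpairing _, ?_⟩
  filter_upwards [hbranch, eventually_localSolution_iff h hδ hα hW hf (η := η) (by linarith),
    self_mem_nhdsWithin] with ε ⟨p, hpS, hp, s, hs, hps⟩ hlocal hε
  refine ⟨p, hpS, fun q => by rw [hlocal, hT, eq_comm (a := q), hp], s, hs, ?_, hps⟩
  have hpair : pairing A φs p.1 = 0 := by
    rw [← ((hp p).2 rfl).2]
    exact hpairing _
  rw [hps, Prod.fst_add, Prod.smul_fst, Prod.smul_fst, map_add, map_smul, map_smul, hpairing,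
    smul_zero, zero_add, smul_eq_mul, mul_eq_zero, Complex.ofReal_eq_zero] at hpair
  exact hpair.resolve_left (Real.rpow_pos_of_pos hε _).ne'

end Branch

section Main

open GraphDomain (mk)

variable {A : Op d} {φ₀ : A.domain}

theorem SimpleEigenvalue.exists_phase_PT_eq {W : Rd d → ℂ → ℂ} {φs : L2 d} {ω₀ δ : ℝ}
    (h : SimpleEigenvalue A W ω₀ φ₀ φs) (hδ : 0 < δ) (hW : AssumptionW W ω₀ δ)
    (hA : PTOperator A) (hPTW : ∀ ω : ℝ, |ω - ω₀| < δ → PTFunction fun x => W x ω) :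
    ∃ c : ℂ, ‖c‖ = 1 ∧ PT (c • (φ₀ : L2 d)) = c • (φ₀ : L2 d) := by
  have hφ₀ : (φ₀ : L2 d) ≠ 0 := fun hzero => by simpa [hzero] using h.inner_one
  obtain ⟨v, hv, hLv⟩ := exists_linearization_eq_PT hA (hW.memLp (Metric.mem_ball_self hδ))
    (hPTW ω₀ (by simpa)) (GraphDomain.mk φ₀)
  rw [apply_eq_zero_of_ker_eq_span h.ker_linearization, PT_zero] at hLv
  have hker : v ∈ ℂ ∙ GraphDomain.mk φ₀ := h.ker_linearization.le hLv
  obtain ⟨a, rfl⟩ := Submodule.mem_span_singleton.1 hker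
  exact PTBif.exists_phase_PT_eq hφ₀ hv.symm

theorem smul_add_eq_expansion {ε α τ : ℝ} (hε : 0 < ε) (e s : GraphDomain A × ℂ) :
    mk.symm (((ε ^ α : ℝ) : ℂ) • (mk φ₀ + ((ε : ℂ) • e + ((ε ^ (1 + τ) : ℝ) : ℂ) • s).1))
      = ((ε ^ α : ℝ) : ℂ) • φ₀ + ((ε ^ (α + 1) : ℝ) : ℂ) • mk.symm e.1
        + ((ε ^ (α + 1 + τ) : ℝ) : ℂ) • mk.symm s.1 := by
  have hα₁ : ((ε ^ (α + 1) : ℝ) : ℂ) = (ε ^ α : ℝ) * ε := by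
    rw [Real.rpow_add hε, Real.rpow_one, Complex.ofReal_mul]
  have hατ : ((ε ^ (α + 1 + τ) : ℝ) : ℂ) = (ε ^ α : ℝ) * (ε ^ (1 + τ) : ℝ) := by
    rw [add_assoc, Real.rpow_add hε α, Complex.ofReal_mul]
  rw [hα₁, hατ, mul_smul, mul_smul, Prod.fst_add, Prod.smul_fst, Prod.smul_fst, ← add_assoc,
    smul_add, smul_add]
  rfl

end Main

end PTBif

end

open PTBif GraphDomain in
theorem proposition2_general {d : ℕ} {A : Op d} {W : Rd d → ℂ → ℂ} {f : Rd d → ℂ → ℂ → ℂ}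
    {g : Rd d → ℂ} {ω₀ : ℝ} {φ₀ : A.domain} {φs : L2 d} {δ α β τ : ℝ} (hδ : 0 < δ) (hα : 0 < α)
    (hτ : 0 ≤ τ) (hτ' : τ ≤ min 1 (α * β)) (h : SimpleEigenvalue A W ω₀ φ₀ φs)
    (hφ₀ : MemLp (φ₀ : L2 d) ∞ volume) (hW : AssumptionW W ω₀ δ) (hWt : Transversal W ω₀ φ₀ φs)
    (hf : AsymptoticNonlinearity A ω₀ φ₀ δ α β f g) (hPT : PTEquivariant A W f ω₀ δ) :
    (∃ c : ℂ, ‖c‖ = 1 ∧ PT (c • (φ₀ : L2 d)) = c • (φ₀ : L2 d)) ∧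
    (PT (φ₀ : L2 d) = φ₀ →
      ∃ ε₀ η r : ℝ, 0 < ε₀ ∧ 0 < η ∧ 0 < r ∧ ∃ (ν : ℂ) (ϕ : A.domain),
        inner ℂ φs (ϕ : L2 d) = 0 ∧
        ∀ ε ∈ Ioo 0 ε₀, ∃ (ω : ℂ) (φ : A.domain),
          LocalSolution A W f ω₀ φ₀ φs α η ε ω φ ∧
          (∀ (ω' : ℂ) (φ' : A.domain),
            LocalSolution A W f ω₀ φ₀ φs α η ε ω' φ' → ω' = ω ∧ φ' = φ) ∧
          (∃ (σ : ℂ) (ψ : A.domain),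
            ‖σ‖ ≤ r ∧ graphNorm A ψ ≤ r ∧ inner ℂ φs (ψ : L2 d) = 0 ∧
            ω = ω₀ + (ε : ℂ) * ν + ((ε ^ (1 + τ) : ℝ) : ℂ) * σ ∧
            φ = ((ε ^ α : ℝ) : ℂ) • φ₀ + ((ε ^ (α + 1) : ℝ) : ℂ) • ϕ
              + ((ε ^ (α + 1 + τ) : ℝ) : ℂ) • ψ) ∧
          ω.im = 0 ∧ PT (φ : L2 d) = φ) := by
  refine ⟨h.exists_phase_PT_eq hδ hW hPT.opA hPT.potential, fun hPTφ₀ => ?_⟩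
  obtain ⟨η, hη, r, hr, e, he, hbranch⟩ := exists_branch h hδ hα hτ hτ' hφ₀ hW hWt hf hPT hPTφ₀
  obtain ⟨ε₀, hε₀, hsub⟩ := mem_nhdsGT_iff_exists_Ioo_subset.1 hbranch
  refine ⟨ε₀, η, r, hε₀, hη, hr, e.2, mk.symm e.1, he, fun ε hε => ?_⟩
  obtain ⟨p, hpS, hp, s, hs, hspair, hps⟩ := hsub hε
  refine ⟨ω₀ + p.2, mk.symm (((ε ^ α : ℝ) : ℂ) • (mk φ₀ + p.1)), (hp p).2 rfl,
    fun ω' φ' hsol => ?_, ⟨s.2, mk.symm s.1, (norm_snd_le s).trans hs, (norm_fst_le s).trans hs,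
      hspair, ?_, ?_⟩, ?_, ?_⟩
  · obtain ⟨q, rfl, rfl⟩ := exists_eq_smul_add (ω₀ := (ω₀ : ℂ)) (φ₀ := φ₀)
      (Complex.ofReal_ne_zero.2 (Real.rpow_pos_of_pos hε.1 α).ne') ω' φ'
    rw [(hp q).1 hsol]
    exact ⟨rfl, rfl⟩
  · rw [hps, add_assoc]
    rfl
  · rw [hps, smul_add_eq_expansion hε.1]
  · rw [Complex.add_im, Complex.ofReal_im, zero_add, Complex.conj_eq_iff_im.1 hpS.2]
  · exact PT_smul_add hPTφ₀ hpS _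

theorem proposition2 (d : ℕ) (hd : 1 ≤ d)
    (A : PTBif.Op d) (W : PTBif.Rd d → ℂ → ℂ)
    (f : PTBif.Rd d → ℂ → ℂ → ℂ) (g : ℂ → PTBif.Rd d → ℂ)
    (ω₀ : ℝ) (φ₀ : A.domain) (φs : PTBif.L2 d)
    (δ α β τ : ℝ) (hδ : 0 < δ) (hα : 0 < α) (hβ : 0 < β)
    (hτ : 0 < τ) (hτ' : τ ≤ min 1 (α * β))
    (hA : PTBif.AssumptionA A)
    (hW : PTBif.AssumptionW W ω₀ δ)
    (hsimple : PTBif.AlgebraicallySimple A W ω₀ φ₀)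
    (hisol : PTBif.Isolated A W ω₀)
    (hnorm : PTBif.Normalized A W ω₀ φ₀ φs)
    (hWt : PTBif.Transversal W ω₀ φ₀ φs)
    (hf : PTBif.AssumptionF A ω₀ φ₀ δ α β f g)
    (hPT : PTBif.PTSymmetricProblem A W f g ω₀ δ) :
    -- the normalized eigenfunction can be chosen symmetric
    (∃ c : ℂ, ‖c‖ = 1 ∧ PTBif.PT (c • (φ₀ : PTBif.L2 d)) = c • (φ₀ : PTBif.L2 d)) ∧
    -- and for such a choice the bifurcating branch is real and symmetric
    (PTBif.PT (φ₀ : PTBif.L2 d) = φ₀ →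
      ∃ ε₀ η r : ℝ, 0 < ε₀ ∧ 0 < η ∧ 0 < r ∧ ∃ (ν : ℂ) (ϕ : A.domain),
        inner ℂ φs (ϕ : PTBif.L2 d) = 0 ∧
        ∀ ε ∈ Set.Ioo 0 ε₀, ∃ (ω : ℂ) (φ : A.domain),
          -- the unique solution near the bifurcation point
          PTBif.LocalSolution A W f ω₀ φ₀ φs α η ε ω φ ∧
          (∀ (ω' : ℂ) (φ' : A.domain),
            PTBif.LocalSolution A W f ω₀ φ₀ φs α η ε ω' φ' → ω' = ω ∧ φ' = φ) ∧
          -- its expansion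
          (∃ (σ : ℂ) (ψ : A.domain),
            ‖σ‖ ≤ r ∧ PTBif.graphNorm A ψ ≤ r ∧ inner ℂ φs (ψ : PTBif.L2 d) = 0 ∧
            ω = ω₀ + (ε : ℂ) * ν + ((ε ^ (1 + τ) : ℝ) : ℂ) * σ ∧
            φ = ((ε ^ α : ℝ) : ℂ) • φ₀ + ((ε ^ (α + 1) : ℝ) : ℂ) • ϕ
              + ((ε ^ (α + 1 + τ) : ℝ) : ℂ) • ψ) ∧
          -- reality and symmetry
          ω.im = 0 ∧ PTBif.PT (φ : PTBif.L2 d) = φ) :=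
  proposition2_general hδ hα hτ.le hτ' (.of_isolated hA hsimple hisol hnorm) (hA.memLp_top φ₀) hW
    hWt (hf.asymptoticNonlinearity hδ) hPT.ptEquivariant
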